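/- Let $\mathbb T=\mathbb R/\mathbb Z$ and, for $N\ge 1$, let $\Gamma_N=\{k/N: k=0,\dots,N-1\}\subset\mathbb T$, so that $\Gamma_N^d$ is a finite subgroup of $\mathbb T^d$. A cube in $\mathbb T^d$ is a product $Q=J_1\times\cdots\times J_d$ of nonempty connected subsets $J_i\subset\mathbb T$ of equal length, and $|Q|$ denotes its normalized Lebesgue measure. For a finite Borel measure $\mu$ on $\mathbb T^d$ write $\widehat\mu(k)=\int_{\mathbb T^d}e^{-2\pi i k\cdot t}\,d\mu(t)$ for $k\in\mathbb Z^d$, and let $\mu^{*\ell}$ be the $\ell$-fold convolution of $\mu$ with itself ($\mu^{*0}=\delta_0$). Proposition. There are $N_0(\beta,\mathfrak n)\ge 1$ depending only on $\beta,\mathfrak n$, and constants $C_1=C_1(d)$, $C_2=C_2(\beta,d)$, $C_3=C_3(\beta,d,\mathfrak n)$ depending only on the indicated parameters, such that the following holds for every integer $d\ge1$, every real $0<\beta<d$ and every integer $\mathfrak n\ge 2$. For all integers $N\ge N_0(\beta,\mathfrak n)$ with $\gcd(\mathfrak n!,N)=1$, setting $P=\lfloor N^\beta\rfloor$, there are $x_1,\dots,x_P\in\Gamma_N^d$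 (not necessarily distinct) such that the measure $$\mu=\frac1P\sum_{j=1}^P\delta_{x_j}$$ satisfies: (i) For all $r\in\Gamma_N^d\setminus\{0\}$, $$|\widehat\mu(Nr)|\le C_1N^{-\beta/2}(\log N)^{1/2},$$ where $Nr$ stands for any $k\in\mathbb Z^d$ such that $k/N$ represents $r$ modulo $\mathbb Z^d$. (ii) For all integers $\ell$ with $1\le\ell\le d/\beta$ and all cubes $Q$ with $|Q|\le N^{-\ell\beta}$, $$\mu^{*\ell}(Q)\le C_2N^{-\ell\beta}\log N.$$ (iii) For all integers $\ell$ with $d/\beta\le\ell\le\mathfrak n$, $$\max_{u\in\Gamma_N^d}\big|\mu^{*\ell}(\{u\})-N^{-d}\big|\le C_3\,\frac{N^{-d}(\log N)^{\frac{\ell+1}2}}{N^{(\ell\beta-d)/2}}.$$ -/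

import Mathlib

open MeasureTheory

noncomputable section

namespace PointMasses

/-- The `d`-dimensional torus `𝕋^d`, where `𝕋 = ℝ/ℤ`. -/
abbrev Torus (d : ℕ) : Type := UnitAddTorus (Fin d)

/-- The grid `Γ_N^d ⊆ 𝕋^d`: all coordinates are of the form `k/N` with `k ∈ {0, …, N - 1}`. -/
def grid (N d : ℕ) : Set (Torus d) :=
  {x | ∀ i, ∃ k : ℕ, k < N ∧ x i = (((k : ℝ) / (N : ℝ) : ℝ) : UnitAddCircle)}

/-- The averaged point mass `(1/P) ∑_j δ_{x_j}`. -/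
def pointMassAverage {d P : ℕ} (x : Fin P → Torus d) : Measure (Torus d) :=
  (P : ENNReal)⁻¹ • ∑ j : Fin P, Measure.dirac (x j)

/-- The convolution powers: `μ^{*0} = δ_0` and `μ^{*(ℓ+1)} = μ * μ^{*ℓ}`. -/
def convPow {d : ℕ} (μ : Measure (Torus d)) : ℕ → Measure (Torus d)
  | 0 => Measure.dirac 0
  | l + 1 => Measure.conv μ (convPow μ l)

/-- The Fourier transform `∫ e^{-2πi k·t} dμ(t)`, `k ∈ ℤ^d`, of a measure on the torus. -/
def fourierTransform {d : ℕ} (μ : Measure (Torus d)) (k : Fin d → ℤ) : ℂ :=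
  ∫ t, UnitAddTorus.mFourier (-k) t ∂μ

/-- A cube in `𝕋^d`: a product of intervals (that is, connected subsets of the circle `𝕋`)
which all have the same length. -/
def IsCube {d : ℕ} (Q : Set (Torus d)) : Prop :=
  ∃ J : Fin d → Set UnitAddCircle, (∀ i, IsConnected (J i)) ∧
    (∀ i j, volume (J i) = volume (J j)) ∧ Q = Set.pi Set.univ J

end PointMasses

end

/-!
The points `x_1, …, x_P` are drawn independently and uniformly from the grid, which is identified
with the finite group `G = (ℤ/N)^d`; with `Λ = log N` every exceptional event below has probability
at most `exp (-D * Λ)` with `D` as large as needed, so that union bounds over polynomially many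
events are free. The sample is treated as a random word `L`, to which letters are added one by
one. Up to the factor `P ^ (-l)`, the mass `μ^{*l}({u})` is the number `repCount l L u` of
`l`-tuples of positions of `L` whose letters add up to `u`. By the binomial theorem
(`repCount_cons`) a new letter `g` changes this number by a combination of the numbers
`repCount (l - k) L (u - k • g)` with `1 ≤ k ≤ l`. This makes the counts of order
`l` a process whose increments are controlled by the counts of lower order, and an
exponential Chebyshev inequality for such processes (`wordProb_lt_le_exp`) allows inductions on `l`.
Bounds on the lower orders
that hold only with high probability are accommodated by stopping the process as
soon as one of them fails.

* Property (i) is Hoeffding's inequality for sums of a nontrivial character of `G`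
  (`wordProb_lt_norm_charSum_le`).
* For (ii), the increments are nonnegative and their means are explicit. If the expected number of
  sums in a set is a negative power of `N`, then this number is `O(1)`
  (`exists_setCount_tail_of_small`); if it is only bounded, then the increments are `O(1)` by the
  first case, and the number is `O(log N)` (`exists_setCount_tail_of_bounded`). The grid points of a
  cube lie in a translate of a box (`exists_box_of_isCube`), so few sets have to be considered.
  Multiplication by `k` need not be injective on `G` here, but it is at most `k ^ d`-to-one.
* For (iii), multiplication by each `k ≤ n` is bijective on `G`, hence the deviations of the counts
  from their means form a martingale. At the first `l` with `d ≤ l * β` its increments are `O(1)`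
  and Bernstein's bound gives square-root fluctuations; for larger `l` the increments are
  bounded by the deviations of order `l - 1`, and Hoeffding's bound suffices (`exists_repDev_tail`).
-/

noncomputable section

open scoped BigOperators

namespace PointMasses

/-! ### Random words and an exponential inequality -/

section Words

variable {G : Type*} [Fintype G]

/-- The mean of `F` over the words of length `m` in the alphabet `G`, all letters being independent
and uniformly distributed. The last letter that is drawn is the head of the word. -/
def wordMean : ℕ → (List G → ℝ) → ℝ
  | 0, F => F []
  | m + 1, F => wordMean m fun L => 𝔼 g, F (g :: L)

open Classical in
/-- The probability that a random word of length `m` satisfies `E`. -/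
def wordProb (m : ℕ) (E : List G → Prop) : ℝ := wordMean m fun L => if E L then 1 else 0

lemma wordMean_mono {m : ℕ} {F F' : List G → ℝ} (h : ∀ L, L.length = m → F L ≤ F' L) :
    wordMean m F ≤ wordMean m F' := by
  induction m generalizing F F' with
  | zero => exact h [] rfl
  | succ m ih =>
    exact ih fun L hL => Finset.expect_le_expect fun g _ => h _ (by simp [hL])

lemma wordMean_add (m : ℕ) (F F' : List G → ℝ) :
    wordMean m (fun L => F L + F' L) = wordMean m F + wordMean m F' := by
  induction m generalizing F F' with
  | zero => rfl
  | succ m ih => simp only [wordMean, Finset.expect_add_distrib, ih]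

lemma wordMean_mul_const (m : ℕ) (F : List G → ℝ) (c : ℝ) :
    wordMean m (fun L => F L * c) = wordMean m F * c := by
  induction m generalizing F with
  | zero => rfl
  | succ m ih => simp only [wordMean, ← Finset.expect_mul, ih]

lemma wordMean_const [Nonempty G] (m : ℕ) (c : ℝ) : wordMean m (fun _ : List G => c) = c := by
  induction m with
  | zero => rfl
  | succ m ih => simpa [wordMean, Fintype.expect_const] using ih

lemma exists_lt_of_wordMean_lt [Nonempty G] {m : ℕ} {F : List G → ℝ} {c : ℝ}
    (h : wordMean m F < c) : ∃ L : List G, L.length = m ∧ F L < c := by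
  by_contra! hc
  have := wordMean_mono (F := fun _ => c) (F' := F) (m := m) hc
  rw [wordMean_const] at this
  exact absurd h this.not_gt

lemma wordProb_mono {m : ℕ} {E E' : List G → Prop} (h : ∀ L, L.length = m → E L → E' L) :
    wordProb m E ≤ wordProb m E' := by
  classical
  refine wordMean_mono fun L hL => ?_
  have := h L hL
  split_ifs <;> simp_all

lemma wordProb_nonneg [Nonempty G] (m : ℕ) (E : List G → Prop) : 0 ≤ wordProb m E := by
  rw [← wordMean_const (G := G) m 0]
  exact wordMean_mono fun L _ => by split_ifs <;> simp

lemma wordProb_false [Nonempty G] {m : ℕ} {E : List G → Prop} (h : ∀ L, L.length = m → ¬ E L) :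
    wordProb m E = 0 := by
  refine le_antisymm ?_ (wordProb_nonneg m E)
  rw [← wordMean_const (G := G) m 0]
  exact wordMean_mono fun L hL => by simp [h L hL]

lemma exists_not_of_wordProb_lt_one [Nonempty G] {m : ℕ} {E : List G → Prop}
    (h : wordProb m E < 1) : ∃ L : List G, L.length = m ∧ ¬ E L := by
  obtain ⟨L, hL, hlt⟩ := exists_lt_of_wordMean_lt h
  refine ⟨L, hL, fun hE => ?_⟩
  rw [if_pos hE] at hlt
  exact lt_irrefl 1 hlt

lemma wordProb_or_le (m : ℕ) (E E' : List G → Prop) :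
    wordProb m (fun L => E L ∨ E' L) ≤ wordProb m E + wordProb m E' := by
  classical
  rw [wordProb, wordProb, wordProb, ← wordMean_add]
  refine wordMean_mono fun L _ => ?_
  by_cases h : E L <;> by_cases h' : E' L <;> simp [h, h']

lemma wordProb_exists_le [Nonempty G] {ι : Type*} (s : Finset ι) (m : ℕ) (E : ι → List G → Prop) :
    wordProb m (fun L => ∃ i ∈ s, E i L) ≤ ∑ i ∈ s, wordProb m (E i) := by
  classical
  induction s using Finset.induction_on with
  | empty => simp [wordProb_false]
  | insert a s ha ih =>
    rw [Finset.sum_insert ha]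
    refine le_trans (wordProb_mono ?_) ((wordProb_or_le m _ _).trans (add_le_add_right ih _))
    simp

lemma wordProb_exists_le_card_mul [Nonempty G] {ι : Type*} (s : Finset ι) (m : ℕ)
    {E : ι → List G → Prop} {δ : ℝ} (h : ∀ i ∈ s, wordProb m (E i) ≤ δ) :
    wordProb m (fun L => ∃ i ∈ s, E i L) ≤ s.card * δ :=
  (wordProb_exists_le s m E).trans (by simpa using Finset.sum_le_card_nsmul s _ δ h)

lemma wordProb_suffix_le [Nonempty G] (m : ℕ) (E : List G → Prop) {δ : ℝ}
    (h : ∀ i ≤ m, wordProb i E ≤ δ) :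
    wordProb m (fun L => ∃ L', L' <:+ L ∧ E L') ≤ (m + 1) * δ := by
  classical
  induction m with
  | zero =>
    refine le_trans (wordProb_mono fun L hL => ?_) ((h 0 le_rfl).trans_eq (by simp))
    obtain rfl := List.length_eq_zero_iff.1 hL
    rintro ⟨L', hL', hE⟩
    rwa [List.suffix_nil.1 hL'] at hE
  | succ m ih =>
    have key : wordProb (m + 1) (fun L => ∃ L', L' <:+ L ∧ E L') ≤
        wordProb (m + 1) E + wordProb (m + 1) (fun L : List G => ∃ L', L' <:+ L.tail ∧ E L') := by
      refine le_trans (wordProb_mono fun L hL => ?_) (wordProb_or_le _ _ _)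
      obtain ⟨g, M, rfl⟩ := List.exists_cons_of_length_eq_add_one hL
      rintro ⟨L', hL', hE⟩
      rcases List.suffix_cons_iff.1 hL' with rfl | hs
      · exact Or.inl hE
      · exact Or.inr ⟨L', hs, hE⟩
    have h2 : wordProb (m + 1) (fun L : List G => ∃ L', L' <:+ L.tail ∧ E L') =
        wordProb m (fun L : List G => ∃ L', L' <:+ L ∧ E L') := by
      simp only [wordProb, wordMean, List.tail_cons]
      refine congrArg (wordMean m) (funext fun L => ?_)
      by_cases hL : ∃ L', L' <:+ L ∧ E L' <;> simp [hL]
    rw [h2] at key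
    have h3 := ih fun i hi => h i (hi.trans m.le_succ)
    have h4 := h (m + 1) le_rfl
    push_cast
    linarith

/-- The exponential Chebyshev inequality for a process `Z` that is adapted to the letters of a
random word and has increments `h`. The bound on the exponential moment of an increment is only
needed after histories that have been good so far; the event that some history was bad is
added to the right-hand side. -/
lemma wordProb_lt_le_exp [Nonempty G] (m : ℕ) (Z : List G → ℝ) (h : List G → G → ℝ)
    (good : List G → Prop) (hZ0 : Z [] = 0) (hZ : ∀ g L, Z (g :: L) = Z L + h L g)
    {s c κ : ℝ} (hs : 0 ≤ s)
    (hexp : ∀ L, L.length < m → good L → 𝔼 g, Real.exp (s * h L g) ≤ Real.exp c) :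
    wordProb m (fun L => κ < Z L) ≤
      wordProb m (fun L => ∃ L', L' <:+ L ∧ ¬ good L') + Real.exp (m * c - s * κ) := by
  classical
  have moment : wordMean m (fun L => if ∀ L', L' <:+ L → good L' then Real.exp (s * Z L) else 0) ≤
      Real.exp (m * c) := by
    induction m with
    | zero =>
      simp only [wordMean, hZ0]
      split_ifs <;> simp
    | succ m ih =>
      have h1 := ih fun L hL => hexp L (hL.trans m.lt_succ_self)
      have h2 : wordMean (m + 1)
            (fun L : List G => if ∀ L', L' <:+ L → good L' then Real.exp (s * Z L) else 0) ≤
          wordMean m (fun L : List G =>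
            (if ∀ L', L' <:+ L → good L' then Real.exp (s * Z L) else 0) * Real.exp c) := by
        rw [wordMean]
        refine wordMean_mono fun L hL => ?_
        by_cases hg : ∀ L', L' <:+ L → good L'
        · rw [if_pos hg]
          refine le_trans ?_ (mul_le_mul_of_nonneg_left
            (hexp L (by omega) (hg L L.suffix_rfl)) (Real.exp_pos _).le)
          rw [Finset.mul_expect]
          refine Finset.expect_le_expect fun g _ => ?_
          rw [hZ, mul_add, Real.exp_add]
          split_ifs
          · exact le_rfl
          · positivity
        · rw [if_neg hg, zero_mul]
          refine (Finset.expect_eq_zero fun g _ => ?_).le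
          rw [if_neg]
          exact fun h' => hg fun L' hL' => h' L' (hL'.trans (List.suffix_cons g L))
      rw [wordMean_mul_const] at h2
      refine h2.trans ((mul_le_mul_of_nonneg_right h1 (Real.exp_pos _).le).trans_eq ?_)
      rw [← Real.exp_add]
      congr 1
      push_cast
      ring
  have split : wordProb m (fun L => κ < Z L) ≤
      wordProb m (fun L => ∃ L', L' <:+ L ∧ ¬ good L') +
        wordMean m (fun L => (if ∀ L', L' <:+ L → good L' then Real.exp (s * Z L) else 0) *
          Real.exp (-(s * κ))) := by
    rw [wordProb, wordProb, ← wordMean_add]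
    refine wordMean_mono fun L _ => ?_
    by_cases hg : ∀ L', L' <:+ L → good L'
    · have hb : ¬ ∃ L', L' <:+ L ∧ ¬ good L' := by push Not; exact hg
      rw [if_neg hb, if_pos hg, zero_add, ← Real.exp_add]
      split_ifs with hk
      · exact Real.one_le_exp (by nlinarith)
      · positivity
    · have hb : ∃ L', L' <:+ L ∧ ¬ good L' := by push Not at hg; exact hg
      rw [if_pos hb, if_neg hg, zero_mul, add_zero]
      split_ifs <;> simp
  rw [wordMean_mul_const] at split
  refine split.trans (add_le_add_right ?_ _)
  refine (mul_le_mul_of_nonneg_right moment (Real.exp_pos _).le).trans_eq ?_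
  rw [← Real.exp_add, sub_eq_add_neg]

/-- Two-sided version of `wordProb_lt_le_exp`. -/
lemma wordProb_lt_abs_le_exp [Nonempty G] (m : ℕ) (Z : List G → ℝ) (h : List G → G → ℝ)
    (good : List G → Prop) (hZ0 : Z [] = 0) (hZ : ∀ g L, Z (g :: L) = Z L + h L g)
    {s c κ : ℝ} (hs : 0 ≤ s)
    (hexp : ∀ L, L.length < m → good L → 𝔼 g, Real.exp (s * h L g) ≤ Real.exp c)
    (hexp' : ∀ L, L.length < m → good L → 𝔼 g, Real.exp (s * -h L g) ≤ Real.exp c) :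
    wordProb m (fun L => κ < |Z L|) ≤
      2 * wordProb m (fun L => ∃ L', L' <:+ L ∧ ¬ good L') + 2 * Real.exp (m * c - s * κ) := by
  have h1 := wordProb_lt_le_exp m Z h good hZ0 hZ (κ := κ) hs hexp
  have h2 := wordProb_lt_le_exp m (fun L => -Z L) (fun L g => -h L g) good (by simp [hZ0])
    (fun g L => by rw [hZ]; ring) (κ := κ) hs hexp'
  have h3 : wordProb m (fun L => κ < |Z L|) ≤
      wordProb m (fun L => κ < Z L) + wordProb m (fun L => κ < -Z L) :=
    (wordProb_mono fun L _ => lt_abs.1).trans (wordProb_or_le m _ _)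
  linarith

/-! ### Exponential moments of bounded random variables -/

/-- Hoeffding's lemma for a centred variable with values in `[-B, B]`. -/
lemma expect_exp_le_of_abs_le [Nonempty G] {f : G → ℝ} {B : ℝ} (hB : ∀ g, |f g| ≤ B)
    (h0 : 𝔼 g, f g = 0) (s : ℝ) : 𝔼 g, Real.exp (s * f g) ≤ Real.exp (s ^ 2 * B ^ 2 / 2) := by
  have hB0 : 0 ≤ B := (abs_nonneg _).trans (hB (Classical.arbitrary G))
  rcases hB0.eq_or_lt with rfl | hBpos
  · have : ∀ g, f g = 0 := fun g => abs_nonpos_iff.1 (hB g)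
    simp [this]
  -- the chord of the convex function `y ↦ exp (s * y)` over `[-B, B]`
  have chord : ∀ g, Real.exp (s * f g) ≤
      Real.cosh (s * B) + f g * (Real.sinh (s * B) / B) := fun g => by
    have hg := abs_le.1 (hB g)
    have := convexOn_exp.2 (Set.mem_univ (s * B)) (Set.mem_univ (-(s * B)))
      (show 0 ≤ (B + f g) / (2 * B) from div_nonneg (by linarith) (by linarith))
      (show 0 ≤ (B - f g) / (2 * B) from div_nonneg (by linarith) (by linarith))
      (by field_simp; ring)
    simp only [smul_eq_mul] at this
    have e1 : (B + f g) / (2 * B) * (s * B) + (B - f g) / (2 * B) * (-(s * B)) = s * f g := by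
      field_simp; ring
    rw [e1] at this
    refine this.trans_eq ?_
    rw [Real.cosh_eq, Real.sinh_eq]
    field_simp; ring
  calc 𝔼 g, Real.exp (s * f g) ≤ 𝔼 g, (Real.cosh (s * B) + f g * (Real.sinh (s * B) / B)) :=
        Finset.expect_le_expect fun g _ => chord g
    _ = Real.cosh (s * B) := by
        rw [Finset.expect_add_distrib, ← Finset.expect_mul, h0, Fintype.expect_const]; simp
    _ ≤ _ := by
        refine (Real.cosh_le_exp_half_sq _).trans_eq ?_
        rw [mul_pow]

/-- Bernstein's exponential moment bound for a centred variable with variance at most `V`. -/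
lemma expect_exp_le_of_variance_le [Nonempty G] {f : G → ℝ} {s V : ℝ}
    (hs : ∀ g, |s * f g| ≤ 1) (h0 : 𝔼 g, f g = 0) (hV : 𝔼 g, f g ^ 2 ≤ V) :
    𝔼 g, Real.exp (s * f g) ≤ Real.exp (s ^ 2 * V) := by
  calc 𝔼 g, Real.exp (s * f g) ≤ 𝔼 g, (1 + f g * s + f g ^ 2 * s ^ 2) := by
        refine Finset.expect_le_expect fun g _ => ?_
        have := (abs_le.1 (Real.abs_exp_sub_one_sub_id_le (hs g))).2
        nlinarith
    _ = 1 + (𝔼 g, f g ^ 2) * s ^ 2 := by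
        rw [Finset.expect_add_distrib, Finset.expect_add_distrib, ← Finset.expect_mul,
          ← Finset.expect_mul, h0, Fintype.expect_const]; simp
    _ ≤ 1 + s ^ 2 * V := by nlinarith [sq_nonneg s]
    _ ≤ _ := by linarith [Real.add_one_le_exp (s ^ 2 * V)]

/-- Exponential moment bound for a nonnegative variable with values in `[0, B]` in terms of its
mean. -/
lemma expect_exp_le_of_nonneg [Nonempty G] {f : G → ℝ} {s B c : ℝ} (hB : 1 ≤ B)
    (hf : ∀ g, 0 ≤ f g) (hfB : ∀ g, f g ≤ B) (hc : 𝔼 g, f g ≤ c) :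
    𝔼 g, Real.exp (s * f g) ≤ Real.exp (c * Real.exp (s * B)) := by
  have chord : ∀ g, Real.exp (s * f g) ≤ 1 + f g * Real.exp (s * B) := fun g => by
    have := convexOn_exp.2 (Set.mem_univ (s * B)) (Set.mem_univ 0)
      (show 0 ≤ f g / B from div_nonneg (hf g) (by linarith))
      (show 0 ≤ 1 - f g / B by rw [sub_nonneg, div_le_one (by linarith)]; exact hfB g) (by ring)
    simp only [smul_eq_mul, mul_zero, add_zero, Real.exp_zero, mul_one] at this
    have e1 : f g / B * (s * B) = s * f g := by field_simp
    rw [e1] at this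
    have h1 : f g / B ≤ f g := div_le_self (hf g) hB
    have h2 : 0 ≤ f g / B := div_nonneg (hf g) (by linarith)
    nlinarith [Real.exp_pos (s * B)]
  calc 𝔼 g, Real.exp (s * f g) ≤ 𝔼 g, (1 + f g * Real.exp (s * B)) :=
        Finset.expect_le_expect fun g _ => chord g
    _ = 1 + (𝔼 g, f g) * Real.exp (s * B) := by
        rw [Finset.expect_add_distrib, ← Finset.expect_mul, Fintype.expect_const]
    _ ≤ 1 + c * Real.exp (s * B) := by nlinarith [Real.exp_pos (s * B)]
    _ ≤ _ := by linarith [Real.add_one_le_exp (c * Real.exp (s * B))]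

end Words

/-! ### Counting representations as sums of letters -/

section Counts

open Classical in
lemma sum_comp_le_of_card_fiber_le {G : Type*} [Fintype G] {f : G → ℝ} (hf : ∀ g, 0 ≤ f g)
    {φ : G → G} {τ : ℝ}
    (h : ∀ w, ((Finset.univ.filter fun g => φ g = w).card : ℝ) ≤ τ) :
    ∑ g, f (φ g) ≤ τ * ∑ w, f w := by
  rw [← Finset.sum_fiberwise Finset.univ φ, Finset.mul_sum]
  refine Finset.sum_le_sum fun w _ => ?_
  rw [Finset.sum_congr rfl (g := fun _ => f w) fun g hg => by rw [(Finset.mem_filter.1 hg).2],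
    Finset.sum_const, nsmul_eq_mul]
  exact mul_le_mul_of_nonneg_right (h w) (hf w)

variable {G : Type*} [AddCommGroup G]

/-- The sum of the letters of a word as an element of the group semiring `ℕ[G]`; it stands for
the unnormalized sum of point masses at the letters. -/
def wordSum (L : List G) : AddMonoidAlgebra ℕ G :=
  (L.map fun g => AddMonoidAlgebra.single g 1).sum

/-- The number of `l`-tuples of positions in the word `L` whose letters add up to `u`. -/
def repCount (l : ℕ) (L : List G) (u : G) : ℕ := (wordSum L ^ l).coeff u

lemma repCount_zero [DecidableEq G] (L : List G) (u : G) :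
    repCount 0 L u = if u = 0 then 1 else 0 := by
  rw [repCount, pow_zero, AddMonoidAlgebra.one_def, AddMonoidAlgebra.coeff_single,
    Finsupp.single_apply]
  simp [eq_comm]

lemma repCount_nil {l : ℕ} (hl : l ≠ 0) (u : G) : repCount l [] u = 0 := by
  simp [repCount, wordSum, hl]

/-- The binomial theorem for the representation counts, sorted by the number of times that the
first letter is used. -/
lemma repCount_cons (l : ℕ) (g : G) (L : List G) (u : G) :
    repCount l (g :: L) u = repCount l L u +
      ∑ k ∈ Finset.range l, l.choose (k + 1) * repCount (l - (k + 1)) L (u - (k + 1) • g) := by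
  have h : repCount l (g :: L) u =
      ∑ k ∈ Finset.range (l + 1), l.choose k * repCount (l - k) L (u - k • g) := by
    simp only [repCount, wordSum, List.map_cons, List.sum_cons]
    rw [add_pow, AddMonoidAlgebra.coeff_sum, Finsupp.finsetSum_apply]
    refine Finset.sum_congr rfl fun k _ => ?_
    rw [← nsmul_eq_mul', AddMonoidAlgebra.coeff_smul, AddMonoidAlgebra.single_pow, one_pow,
      Finsupp.smul_apply, AddMonoidAlgebra.coeff_single_mul_apply, smul_eq_mul, one_mul,
      neg_add_eq_sub]
  rw [h, Finset.sum_range_succ', add_comm]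
  simp

lemma sum_repCount [Fintype G] (l : ℕ) (L : List G) : ∑ u, repCount l L u = L.length ^ l := by
  classical
  induction L generalizing l with
  | nil =>
    rcases eq_or_ne l 0 with rfl | hl
    · simp [repCount_zero]
    · simp [repCount_nil hl, hl]
  | cons g L ih =>
    have shift : ∀ j (w : G), ∑ u, repCount j L (u - w) = L.length ^ j := fun j w => by
      rw [← ih j]
      exact Fintype.sum_equiv (Equiv.subRight w) _ _ fun _ => rfl
    simp only [repCount_cons, Finset.sum_add_distrib, ih]
    rw [Finset.sum_comm]
    simp only [← Finset.mul_sum, shift]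
    rw [List.length_cons, add_comm L.length 1, add_pow, Finset.sum_range_succ' _ l, add_comm]
    simp [mul_comm]

/-- The number of `l`-tuples of positions in the word `L` whose letters add up to an element
of `A - v`. -/
def setCount (l : ℕ) (L : List G) (A : Finset G) (v : G) : ℝ := ∑ a ∈ A, (repCount l L (a - v) : ℝ)

lemma setCount_nonneg (l : ℕ) (L : List G) (A : Finset G) (v : G) : 0 ≤ setCount l L A v :=
  Finset.sum_nonneg fun _ _ => Nat.cast_nonneg _

lemma setCount_singleton (l : ℕ) (L : List G) (u : G) :
    setCount l L {u} 0 = repCount l L u := by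
  simp [setCount]

lemma setCount_nil {l : ℕ} (hl : l ≠ 0) (A : Finset G) (v : G) : setCount l [] A v = 0 := by
  simp [setCount, repCount_nil hl]

lemma setCount_zero_le (L : List G) (A : Finset G) (v : G) : setCount 0 L A v ≤ 1 := by
  classical
  simp only [setCount, repCount_zero, sub_eq_zero]
  push_cast
  rw [Finset.sum_ite_eq']
  split_ifs <;> simp

lemma setCount_cons (l : ℕ) (g : G) (L : List G) (A : Finset G) (v : G) :
    setCount l (g :: L) A v = setCount l L A v +
      ∑ k ∈ Finset.range l, l.choose (k + 1) * setCount (l - (k + 1)) L A (v + (k + 1) • g) := by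
  simp only [setCount, repCount_cons, Nat.cast_add, Nat.cast_sum, Nat.cast_mul,
    Finset.sum_add_distrib, Finset.mul_sum, sub_add_eq_sub_sub]
  rw [Finset.sum_comm]

lemma setCount_mono_suffix {L L' : List G} (h : L' <:+ L) (l : ℕ) (A : Finset G) (v : G) :
    setCount l L' A v ≤ setCount l L A v := by
  induction L with
  | nil => rw [List.suffix_nil.1 h]
  | cons g L ih =>
    rcases List.suffix_cons_iff.1 h with rfl | h
    · exact le_rfl
    · refine (ih h).trans ?_
      rw [setCount_cons]
      exact le_add_of_nonneg_right
        (Finset.sum_nonneg fun k _ => mul_nonneg (Nat.cast_nonneg _) (setCount_nonneg _ _ _ _))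

open Classical in
/-- Averaging over a fresh letter that is used `k` times, when multiplication by `k` is at most
`τ`-to-one on `G`. -/
lemma expect_setCount_le [Fintype G] {k : ℕ} {τ : ℝ}
    (h : ∀ w : G, ((Finset.univ.filter fun g : G => k • g = w).card : ℝ) ≤ τ)
    (j : ℕ) (L : List G) (A : Finset G) (v : G) :
    𝔼 g, setCount j L A (v + k • g) ≤ τ * A.card * L.length ^ j / Fintype.card G := by
  rw [Fintype.expect_eq_sum_div_card]
  refine div_le_div_of_nonneg_right ?_ (Nat.cast_nonneg _)
  simp only [setCount]
  rw [Finset.sum_comm]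
  have key : ∀ a ∈ A, ∑ g, (repCount j L (a - (v + k • g)) : ℝ) ≤ τ * L.length ^ j := by
    intro a _
    have h1 := sum_comp_le_of_card_fiber_le (f := fun w => (repCount j L w : ℝ))
      (φ := fun g => a - (v + k • g)) (τ := τ) (fun _ => Nat.cast_nonneg _) fun w => by
        refine le_trans (le_of_eq ?_) (h (a - v - w))
        congr 2
        ext g
        simp only [Finset.mem_filter, Finset.mem_univ, true_and]
        constructor
        · rintro rfl; abel
        · rintro hg; rw [hg]; abel
    have h2 : ∑ w, (repCount j L w : ℝ) = L.length ^ j := by exact_mod_cast sum_repCount j L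
    rwa [h2] at h1
  refine (Finset.sum_le_card_nsmul A _ _ key).trans_eq ?_
  rw [nsmul_eq_mul]
  ring

lemma sum_choose_succ_le (l : ℕ) : ∑ k ∈ Finset.range l, (l.choose (k + 1) : ℝ) ≤ 2 ^ l := by
  have h : ∑ k ∈ Finset.range (l + 1), (l.choose k : ℝ) = 2 ^ l := by
    exact_mod_cast Nat.sum_range_choose l
  rw [← h, Finset.sum_range_succ']
  simp

end Counts

/-! ### Upper tails for the number of representations -/

lemma exp_add_exp_le {D Λ : ℝ} (hΛ : 1 ≤ Λ) :
    Real.exp (-(D + 1) * Λ) + Real.exp (-(D + 1) * Λ) ≤ Real.exp (-D * Λ) := by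
  have h : Real.exp (-D * Λ) = Real.exp (-(D + 1) * Λ) * Real.exp Λ := by
    rw [← Real.exp_add]; congr 1; ring
  rw [h]
  nlinarith [Real.add_one_le_exp Λ, Real.exp_pos (-(D + 1) * Λ)]

lemma natCast_le_exp_mul (l : ℕ) {Λ : ℝ} (hΛ : 1 ≤ Λ) : (l : ℝ) ≤ Real.exp (l * Λ) := by
  have h1 := Real.add_one_le_exp ((l : ℝ) * Λ)
  nlinarith [(Nat.cast_nonneg l : (0 : ℝ) ≤ l)]

lemma wordProb_exists_lt_exists_le {G : Type*} [Fintype G] [Nonempty G] {l m : ℕ} {δ D Λ : ℝ}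
    (hΛ : 1 ≤ Λ) (hG : (Fintype.card G : ℝ) ≤ Real.exp (δ * Λ)) {E : ℕ → G → List G → Prop}
    (h : ∀ j < l, ∀ w, wordProb m (E j w) ≤ Real.exp (-(D + l + δ) * Λ)) :
    wordProb m (fun L => ∃ j ∈ Finset.range l, ∃ w ∈ Finset.univ, E j w L) ≤
      Real.exp (-D * Λ) := by
  have h1 := wordProb_exists_le_card_mul (Finset.range l) m
    (E := fun j L => ∃ w ∈ Finset.univ, E j w L) fun j hj =>
      wordProb_exists_le_card_mul Finset.univ m fun w _ => h j (Finset.mem_range.1 hj) w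
  refine h1.trans ?_
  rw [Finset.card_range, Finset.card_univ]
  have h2 := natCast_le_exp_mul l hΛ
  calc (l : ℝ) * (Fintype.card G * Real.exp (-(D + l + δ) * Λ))
      ≤ Real.exp (l * Λ) * (Real.exp (δ * Λ) * Real.exp (-(D + l + δ) * Λ)) := by gcongr
    _ = Real.exp (-D * Λ) := by
        rw [← Real.exp_add, ← Real.exp_add]; congr 1; ring

open Classical in
/-- Multiplication by each of `1, …, l` is at most `τ`-to-one on `G`. -/
def FiberBound (G : Type*) [AddCommGroup G] [Fintype G] (l : ℕ) (τ : ℝ) : Prop :=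
  ∀ k, 1 ≤ k → k ≤ l → ∀ w : G, ((Finset.univ.filter fun g : G => k • g = w).card : ℝ) ≤ τ

lemma FiberBound.mono {G : Type*} [AddCommGroup G] [Fintype G] {j l : ℕ} {τ : ℝ}
    (h : FiberBound G l τ) (hj : j ≤ l) : FiberBound G j τ :=
  fun k h1 h2 => h k h1 (h2.trans hj)

/-- A new letter increases the number of representations by a nonnegative amount, which is bounded
by the numbers of shorter representations and has a small mean. -/
lemma setCount_tail_step {G : Type*} [AddCommGroup G] [Fintype G] {l P m : ℕ} {τ B s κ : ℝ}
    (hτ0 : 0 ≤ τ) (hτ : FiberBound G l τ) (hl : l ≠ 0) (hP : 1 ≤ P) (hm : m ≤ P) (hB : 1 ≤ B)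
    (hs : 0 ≤ s) (A : Finset G) (v : G) :
    wordProb m (fun L => κ < setCount l L A v) ≤
      wordProb m (fun L => ∃ j ∈ Finset.range l, ∃ w ∈ Finset.univ, B < setCount j L A w) +
      Real.exp (2 ^ l * τ * (P ^ l * A.card / Fintype.card G) * Real.exp (s * (2 ^ l * B)) -
        s * κ) := by
  have hPR : (1 : ℝ) ≤ P := by exact_mod_cast hP
  have hG : (0 : ℝ) < Fintype.card G := by exact_mod_cast Fintype.card_pos
  set c : ℝ := 2 ^ l * (τ * A.card * P ^ (l - 1) / Fintype.card G) with hc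
  have main := wordProb_lt_le_exp m (fun L => setCount l L A v)
    (fun L g => ∑ k ∈ Finset.range l,
      l.choose (k + 1) * setCount (l - (k + 1)) L A (v + (k + 1) • g))
    (fun L => ∀ j < l, ∀ w, setCount j L A w ≤ B) (setCount_nil hl A v)
    (fun g L => setCount_cons l g L A v) (s := s)
    (c := c * Real.exp (s * (2 ^ l * B))) (κ := κ) hs ?_
  · refine main.trans (add_le_add ?_ (Real.exp_le_exp.2 ?_))
    · refine wordProb_mono fun L _ => ?_
      rintro ⟨L', hL', hbad⟩
      push Not at hbad
      obtain ⟨j, hj, w, hw⟩ := hbad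
      exact ⟨j, Finset.mem_range.2 hj, w, Finset.mem_univ w,
        hw.trans_le (setCount_mono_suffix hL' j A w)⟩
    · refine sub_le_sub_right ?_ _
      rw [← mul_assoc]
      refine mul_le_mul_of_nonneg_right ?_ (Real.exp_pos _).le
      have hc0 : 0 ≤ c := by positivity
      calc (m : ℝ) * c ≤ P * c := by gcongr
        _ = _ := by
          obtain ⟨j, rfl⟩ := Nat.exists_eq_succ_of_ne_zero hl
          simp only [hc, Nat.succ_eq_add_one, Nat.add_sub_cancel]
          ring
  · intro L hL hgood
    refine expect_exp_le_of_nonneg ?_ (fun g => ?_) (fun g => ?_) ?_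
    · nlinarith [one_le_pow₀ (n := l) (one_le_two (α := ℝ))]
    · exact Finset.sum_nonneg fun k _ => mul_nonneg (Nat.cast_nonneg _) (setCount_nonneg _ _ _ _)
    · calc _ ≤ ∑ k ∈ Finset.range l, (l.choose (k + 1) : ℝ) * B := by
            refine Finset.sum_le_sum fun k hk => ?_
            have hk := Finset.mem_range.1 hk
            exact mul_le_mul_of_nonneg_left (hgood _ (by omega) _) (Nat.cast_nonneg _)
        _ ≤ 2 ^ l * B := by
            rw [← Finset.sum_mul]
            exact mul_le_mul_of_nonneg_right (sum_choose_succ_le l) (by linarith)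
    · rw [Finset.expect_sum_comm]
      calc _ ≤ ∑ k ∈ Finset.range l, (l.choose (k + 1) : ℝ) *
              (τ * A.card * P ^ (l - 1) / Fintype.card G) := by
            refine Finset.sum_le_sum fun k hk => ?_
            have hk := Finset.mem_range.1 hk
            rw [← Finset.mul_expect]
            refine mul_le_mul_of_nonneg_left ?_ (Nat.cast_nonneg _)
            refine (expect_setCount_le (hτ (k + 1) (by omega) (by omega)) _ L A v).trans ?_
            have h1 : (L.length : ℝ) ^ (l - (k + 1)) ≤ P ^ (l - 1) :=
              calc (L.length : ℝ) ^ (l - (k + 1)) ≤ (P : ℝ) ^ (l - (k + 1)) := by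
                    gcongr; exact_mod_cast (hL.le.trans hm)
                _ ≤ _ := pow_le_pow_right₀ hPR (by omega)
            gcongr
        _ ≤ c := by
            rw [← Finset.sum_mul]
            exact mul_le_mul_of_nonneg_right (sum_choose_succ_le l) (by positivity)

/-- If the expected number of representations is a negative power of `exp Λ`, then this number is
bounded except with very small probability. -/
theorem exists_setCount_tail_of_small (l : ℕ) : ∀ τ C₀ ε δ D : ℝ, 0 ≤ τ → 0 ≤ C₀ → 0 < ε →
    ∃ K : ℝ, 1 ≤ K ∧ ∀ (G : Type) [AddCommGroup G] [Fintype G] (Λ : ℝ) (P m : ℕ) (A : Finset G)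
      (v : G), 1 ≤ Λ → (Fintype.card G : ℝ) ≤ Real.exp (δ * Λ) → FiberBound G l τ → 1 ≤ P → m ≤ P →
      (P : ℝ) ^ l * A.card / Fintype.card G ≤ C₀ * Real.exp (-ε * Λ) →
      wordProb m (fun L => K < setCount l L A v) ≤ Real.exp (-D * Λ) := by
  induction l using Nat.strong_induction_on with
  | _ l ih =>
  intro τ C₀ ε δ D hτ hC₀ hε
  rcases eq_or_ne l 0 with rfl | hl
  · refine ⟨1, le_rfl, fun G _ _ Λ P m A v _ _ _ _ _ _ => ?_⟩
    rw [wordProb_false fun L _ => (setCount_zero_le L A v).not_gt]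
    exact (Real.exp_pos _).le
  · have ih' : ∀ j : Fin l, _ := fun j => ih j j.2 τ C₀ ε δ (D + 1 + l + δ) hτ hC₀ hε
    choose K hK1 hK using ih'
    set B : ℝ := 1 + ∑ j, K j with hBdef
    have hB : 1 ≤ B := by
      have : 0 ≤ ∑ j, K j := Finset.sum_nonneg fun j _ => zero_le_one.trans (hK1 j)
      linarith
    have hKB : ∀ j, K j ≤ B := fun j => by
      have := Finset.single_le_sum (fun i _ => zero_le_one.trans (hK1 i)) (Finset.mem_univ j)
      linarith
    set B' : ℝ := 2 ^ l * B with hB'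
    have hB'0 : 0 < B' := by positivity
    set K₀ : ℝ := B' * (|D + 1| + 2 ^ l * τ * C₀) / ε with hK₀
    have hK₀0 : 0 ≤ K₀ := by positivity
    refine ⟨K₀ + 1, by linarith, fun G _ _ Λ P m A v hΛ hG hfib hP hm hE => ?_⟩
    -- the choice of `s` turns `exp (s * B')` into `exp (ε * Λ)`, which the small mean absorbs
    have step := setCount_tail_step (s := ε * Λ / B') (κ := K₀ + 1) hτ hfib hl hP hm hB
      (by positivity) A v
    refine step.trans (le_trans (add_le_add ?_ ?_) (exp_add_exp_le hΛ))
    · refine wordProb_exists_lt_exists_le hΛ hG fun j hj w => ?_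
      refine le_trans (wordProb_mono fun L _ h => (hKB ⟨j, hj⟩).trans_lt h) ?_
      refine hK ⟨j, hj⟩ G Λ P m A w hΛ hG (hfib.mono hj.le) hP hm (le_trans ?_ hE)
      gcongr
      exact_mod_cast hP
    · refine Real.exp_le_exp.2 ?_
      have e1 : ε * Λ / B' * (2 ^ l * B) = ε * Λ := by
        rw [← hB']; field_simp
      rw [e1]
      have h1 : 2 ^ l * τ * ((P : ℝ) ^ l * A.card / Fintype.card G) * Real.exp (ε * Λ) ≤
          2 ^ l * τ * C₀ := by
        calc _ ≤ 2 ^ l * τ * (C₀ * Real.exp (-ε * Λ)) * Real.exp (ε * Λ) := by gcongr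
          _ = 2 ^ l * τ * C₀ * (Real.exp (-ε * Λ) * Real.exp (ε * Λ)) := by ring
          _ = _ := by rw [← Real.exp_add]; simp
      have h2 : ε * Λ / B' * (K₀ + 1) = Λ * (|D + 1| + 2 ^ l * τ * C₀) + ε * Λ / B' := by
        rw [hK₀]; field_simp
      have h3 : 0 ≤ ε * Λ / B' := by positivity
      have h4 : 2 ^ l * τ * C₀ ≤ Λ * (2 ^ l * τ * C₀) :=
        le_mul_of_one_le_left (by positivity) hΛ
      have h5 : Λ * (D + 1) ≤ Λ * |D + 1| := by gcongr; exact le_abs_self _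
      rw [h2]
      linarith

/-- If the expected number of representations is bounded, and shorter sums have few representations
on average, then the number of representations is `O(Λ)` except with very small probability. -/
theorem exists_setCount_tail_of_bounded (l : ℕ) (hl : l ≠ 0) (τ C₀ ε δ D : ℝ) (hτ : 0 ≤ τ)
    (hC₀ : 0 ≤ C₀) (hε : 0 < ε) :
    ∃ K : ℝ, 0 ≤ K ∧ ∀ (G : Type) [AddCommGroup G] [Fintype G] (Λ : ℝ) (P m : ℕ) (A : Finset G)
      (v : G), 1 ≤ Λ → (Fintype.card G : ℝ) ≤ Real.exp (δ * Λ) → FiberBound G l τ → 1 ≤ P → m ≤ P →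
      (P : ℝ) ^ l * A.card / Fintype.card G ≤ C₀ →
      (P : ℝ) ^ (l - 1) * A.card / Fintype.card G ≤ C₀ * Real.exp (-ε * Λ) →
      wordProb m (fun L => K * Λ < setCount l L A v) ≤ Real.exp (-D * Λ) := by
  have ih' : ∀ j : Fin l, _ := fun j =>
    exists_setCount_tail_of_small j τ C₀ ε δ (D + 1 + l + δ) hτ hC₀ hε
  choose K hK1 hK using ih'
  set B : ℝ := 1 + ∑ j, K j with hBdef
  have hB : 1 ≤ B := by
    have : 0 ≤ ∑ j, K j := Finset.sum_nonneg fun j _ => zero_le_one.trans (hK1 j)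
    linarith
  have hKB : ∀ j, K j ≤ B := fun j => by
    have := Finset.single_le_sum (fun i _ => zero_le_one.trans (hK1 i)) (Finset.mem_univ j)
    linarith
  set B' : ℝ := 2 ^ l * B with hB'
  have hB'0 : 0 < B' := by positivity
  set K₀ : ℝ := B' * (|D + 1| + 2 ^ l * τ * C₀ * Real.exp 1) with hK₀
  refine ⟨K₀, by positivity, fun G _ _ Λ P m A v hΛ hG hfib hP hm hE hE' => ?_⟩
  have step := setCount_tail_step (s := 1 / B') (κ := K₀ * Λ) hτ hfib hl hP hm hB
    (by positivity) A v
  refine step.trans (le_trans (add_le_add ?_ ?_) (exp_add_exp_le hΛ))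
  · refine wordProb_exists_lt_exists_le hΛ hG fun j hj w => ?_
    refine le_trans (wordProb_mono fun L _ h => (hKB ⟨j, hj⟩).trans_lt h) ?_
    refine hK ⟨j, hj⟩ G Λ P m A w hΛ hG (hfib.mono hj.le) hP hm (le_trans ?_ hE')
    gcongr
    · exact_mod_cast hP
    · exact Nat.le_sub_one_of_lt hj
  · refine Real.exp_le_exp.2 ?_
    have e1 : 1 / B' * (2 ^ l * B) = 1 := by
      rw [← hB']; field_simp
    rw [e1]
    have h1 : 2 ^ l * τ * ((P : ℝ) ^ l * A.card / Fintype.card G) * Real.exp 1 ≤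
        2 ^ l * τ * C₀ * Real.exp 1 := by gcongr
    have h2 : 1 / B' * (K₀ * Λ) = Λ * |D + 1| + Λ * (2 ^ l * τ * C₀ * Real.exp 1) := by
      rw [hK₀]; field_simp
    have h4 : 2 ^ l * τ * C₀ * Real.exp 1 ≤ Λ * (2 ^ l * τ * C₀ * Real.exp 1) :=
      le_mul_of_one_le_left (by positivity) hΛ
    have h5 : Λ * (D + 1) ≤ Λ * |D + 1| := by gcongr; exact le_abs_self _
    rw [h2]
    linarith

/-! ### Fluctuations of the number of representations -/

section Deviation

variable {G : Type*} [AddCommGroup G] [Fintype G]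

/-- The deviation of a representation count from its expected value for tuples of independent,
uniformly distributed letters. -/
def repDev (l : ℕ) (L : List G) (u : G) : ℝ :=
  repCount l L u - (L.length : ℝ) ^ l / Fintype.card G

lemma repDev_nil {l : ℕ} (hl : l ≠ 0) (u : G) : repDev l [] u = 0 := by
  simp [repDev, repCount_nil hl, hl]

lemma repDev_cons (l : ℕ) (g : G) (L : List G) (u : G) :
    repDev l (g :: L) u = repDev l L u +
      ∑ k ∈ Finset.range l, l.choose (k + 1) * repDev (l - (k + 1)) L (u - (k + 1) • g) := by
  have h : ((L.length : ℝ) + 1) ^ l = (L.length : ℝ) ^ l +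
      ∑ k ∈ Finset.range l, (l.choose (k + 1) : ℝ) * (L.length : ℝ) ^ (l - (k + 1)) := by
    rw [add_comm (L.length : ℝ) 1, add_pow, Finset.sum_range_succ' _ l, add_comm]
    simp [mul_comm]
  simp only [repDev, repCount_cons, List.length_cons, Nat.cast_add, Nat.cast_one, h, Nat.cast_sum,
    Nat.cast_mul, mul_sub, Finset.sum_sub_distrib, add_div, Finset.sum_div, mul_div_assoc]
  ring

lemma abs_repDev_le (l : ℕ) (L : List G) (u : G) :
    |repDev l L u| ≤ repCount l L u + (L.length : ℝ) ^ l / Fintype.card G := by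
  refine (abs_sub _ _).trans_eq ?_
  rw [abs_of_nonneg (Nat.cast_nonneg _), abs_of_nonneg (by positivity)]

/-- Multiplication by each of `1, …, l` is a bijection of `G`. -/
def BijectiveNSMul (G : Type*) [AddCommGroup G] (l : ℕ) : Prop :=
  ∀ k, 1 ≤ k → k ≤ l → Function.Bijective fun g : G => k • g

omit [Fintype G] in
lemma BijectiveNSMul.mono {j l : ℕ} (h : BijectiveNSMul G l) (hj : j ≤ l) : BijectiveNSMul G j :=
  fun k h1 h2 => h k h1 (h2.trans hj)

lemma BijectiveNSMul.fiberBound {l : ℕ} (h : BijectiveNSMul G l) : FiberBound G l 1 := by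
  classical
  intro k h1 h2 w
  have : (Finset.univ.filter fun g : G => k • g = w).card ≤ 1 :=
    Finset.card_le_one.2 fun a ha b hb => (h k h1 h2).1 (by simp_all)
  exact_mod_cast this

lemma expect_sub_nsmul {k : ℕ} (h : Function.Bijective fun g : G => k • g) (u : G) (f : G → ℝ) :
    𝔼 g, f (u - k • g) = 𝔼 w, f w :=
  Fintype.expect_bijective (fun g => u - k • g) ((Equiv.subLeft u).bijective.comp h) _ _
    fun _ => rfl

lemma expect_repCount (l : ℕ) (L : List G) :
    𝔼 w, (repCount l L w : ℝ) = (L.length : ℝ) ^ l / Fintype.card G := by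
  rw [Fintype.expect_eq_sum_div_card]
  congr 1
  exact_mod_cast sum_repCount l L

lemma expect_repDev (l : ℕ) (L : List G) : 𝔼 w, repDev l L w = 0 := by
  simp only [repDev]
  rw [Finset.expect_sub_distrib, expect_repCount, Fintype.expect_const, sub_self]

lemma expect_abs_repDev_le (l : ℕ) (L : List G) :
    𝔼 w, |repDev l L w| ≤ 2 * ((L.length : ℝ) ^ l / Fintype.card G) := by
  refine (Finset.expect_le_expect fun w _ => abs_repDev_le l L w).trans_eq ?_
  rw [Finset.expect_add_distrib, expect_repCount, Fintype.expect_const]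
  ring

/-- The change of `repDev l L u` when the letter `g` is put in front of `L`. -/
def repDevStep (l : ℕ) (u : G) (L : List G) (g : G) : ℝ :=
  ∑ k ∈ Finset.range l, l.choose (k + 1) * repDev (l - (k + 1)) L (u - (k + 1) • g)

lemma expect_repDevStep {l : ℕ} (h : BijectiveNSMul G l) (u : G) (L : List G) :
    𝔼 g, repDevStep l u L g = 0 := by
  simp only [repDevStep]
  rw [Finset.expect_sum_comm]
  refine Finset.sum_eq_zero fun k hk => ?_
  rw [← Finset.mul_expect, expect_sub_nsmul (h (k + 1) (by omega)
    (by have := Finset.mem_range.1 hk; omega)) u, expect_repDev, mul_zero]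

lemma abs_repDevStep_le {l : ℕ} {B : ℝ} {L : List G} (hB0 : 0 ≤ B)
    (hB : ∀ j < l, ∀ w, |repDev j L w| ≤ B) (u g : G) : |repDevStep l u L g| ≤ 2 ^ l * B := by
  calc |repDevStep l u L g| ≤ ∑ k ∈ Finset.range l, (l.choose (k + 1) : ℝ) * B := by
        refine (Finset.abs_sum_le_sum_abs _ _).trans (Finset.sum_le_sum fun k hk => ?_)
        have hk := Finset.mem_range.1 hk
        rw [abs_mul, abs_of_nonneg (Nat.cast_nonneg _)]
        exact mul_le_mul_of_nonneg_left (hB _ (by omega) _) (Nat.cast_nonneg _)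
    _ ≤ 2 ^ l * B := by
        rw [← Finset.sum_mul]
        exact mul_le_mul_of_nonneg_right (sum_choose_succ_le l) hB0

lemma expect_repDevStep_sq_le {l P : ℕ} {B : ℝ} {L : List G} (h : BijectiveNSMul G l)
    (hB0 : 0 ≤ B) (hB : ∀ j < l, ∀ w, |repDev j L w| ≤ B) (hP : 1 ≤ P) (hL : L.length ≤ P) (u : G) :
    𝔼 g, repDevStep l u L g ^ 2 ≤
      2 ^ l * B * (2 ^ l * (2 * ((P : ℝ) ^ (l - 1) / Fintype.card G))) := by
  have hPR : (1 : ℝ) ≤ P := by exact_mod_cast hP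
  calc 𝔼 g, repDevStep l u L g ^ 2
      ≤ 𝔼 g, 2 ^ l * B * ∑ k ∈ Finset.range l,
          (l.choose (k + 1) : ℝ) * |repDev (l - (k + 1)) L (u - (k + 1) • g)| := by
        refine Finset.expect_le_expect fun g _ => ?_
        rw [← sq_abs, sq]
        refine mul_le_mul (abs_repDevStep_le hB0 hB u g) ?_ (abs_nonneg _) (by positivity)
        refine (Finset.abs_sum_le_sum_abs _ _).trans_eq (Finset.sum_congr rfl fun k _ => ?_)
        rw [abs_mul, abs_of_nonneg (Nat.cast_nonneg _)]
    _ = 2 ^ l * B * ∑ k ∈ Finset.range l,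
          (l.choose (k + 1) : ℝ) * 𝔼 w, |repDev (l - (k + 1)) L w| := by
        rw [← Finset.mul_expect, Finset.expect_sum_comm]
        congr 1
        refine Finset.sum_congr rfl fun k hk => ?_
        have hk := Finset.mem_range.1 hk
        rw [← Finset.mul_expect]
        congr 1
        exact expect_sub_nsmul (h (k + 1) (by omega) (by omega)) u fun w =>
          |repDev (l - (k + 1)) L w|
    _ ≤ 2 ^ l * B * ∑ k ∈ Finset.range l,
          (l.choose (k + 1) : ℝ) * (2 * ((P : ℝ) ^ (l - 1) / Fintype.card G)) := by
        gcongr with k hk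
        refine (expect_abs_repDev_le _ L).trans ?_
        have h1 : (L.length : ℝ) ^ (l - (k + 1)) ≤ P ^ (l - 1) :=
          calc (L.length : ℝ) ^ (l - (k + 1)) ≤ (P : ℝ) ^ (l - (k + 1)) := by gcongr
            _ ≤ _ := pow_le_pow_right₀ hPR (by omega)
        gcongr
    _ ≤ _ := by
        rw [← Finset.sum_mul]
        have := sum_choose_succ_le l
        gcongr

/-- Some deviation of order below `l` has exceeded `B` at some time. -/
def LargeLowerDev (l : ℕ) (B : ℝ) (L : List G) : Prop :=
  ∃ L', L' <:+ L ∧ ∃ j ∈ Finset.range l, ∃ w ∈ Finset.univ, B < |repDev j L' w|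

lemma two_mul_add_two_mul_exp_le {D Λ p q : ℝ} (hΛ : 1 ≤ Λ) (hp : p ≤ Real.exp (-(D + 2) * Λ))
    (hq : q ≤ Real.exp (-(D + 2) * Λ)) : 2 * p + 2 * q ≤ Real.exp (-D * Λ) := by
  have h1 := exp_add_exp_le (D := D) hΛ
  have h2 := exp_add_exp_le (D := D + 1) hΛ
  rw [show D + 1 + 1 = D + 2 by ring] at h2
  linarith

/-- Fluctuations by Hoeffding's inequality: all increments are at most `2 ^ l * B`. -/
lemma repDev_tail_of_hoeffding {l P m : ℕ} {B Λ D : ℝ} (h : BijectiveNSMul G l) (hl : l ≠ 0)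
    (hP : 1 ≤ P) (hm : m ≤ P) (hB : 0 < B) (hΛ : 1 ≤ Λ) (u : G)
    (hlow : wordProb m (LargeLowerDev (G := G) l B) ≤ Real.exp (-(D + 2) * Λ)) :
    wordProb m (fun L => 2 ^ l * (|D + 2| + 1) * B * √(P * Λ) < |repDev l L u|) ≤
      Real.exp (-D * Λ) := by
  have hPR : (0 : ℝ) < P := by exact_mod_cast hP
  set s : ℝ := √(Λ / P) / (2 ^ l * B) with hs
  have hs2 : s ^ 2 * (2 ^ l * B) ^ 2 = Λ / P := by
    rw [hs, ← mul_pow, div_mul_cancel₀ _ (by positivity), Real.sq_sqrt (by positivity)]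
  have hgood : ∀ L : List G, (∀ j < l, ∀ w, |repDev j L w| ≤ B) →
      (𝔼 g, Real.exp (s * repDevStep l u L g) ≤ Real.exp (s ^ 2 * (2 ^ l * B) ^ 2 / 2)) ∧
      𝔼 g, Real.exp (s * -repDevStep l u L g) ≤ Real.exp (s ^ 2 * (2 ^ l * B) ^ 2 / 2) := by
    intro L hL
    refine ⟨expect_exp_le_of_abs_le (fun g => abs_repDevStep_le hB.le hL u g)
      (expect_repDevStep h u L) s, expect_exp_le_of_abs_le (f := fun g => -repDevStep l u L g)
      (fun g => (abs_neg _).trans_le (abs_repDevStep_le hB.le hL u g)) ?_ s⟩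
    rw [Finset.expect_neg_distrib, expect_repDevStep h u L, neg_zero]
  have main := wordProb_lt_abs_le_exp m (fun L => repDev l L u) (repDevStep l u)
    (fun L => ∀ j < l, ∀ w, |repDev j L w| ≤ B) (repDev_nil hl u) (fun g L => repDev_cons l g L u)
    (s := s) (κ := 2 ^ l * (|D + 2| + 1) * B * √(P * Λ)) (by positivity)
    (fun L _ hL => (hgood L hL).1) (fun L _ hL => (hgood L hL).2)
  refine main.trans (two_mul_add_two_mul_exp_le hΛ ?_ (Real.exp_le_exp.2 ?_))
  · refine le_trans (wordProb_mono fun L _ => ?_) hlow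
    rintro ⟨L', hL', hbad⟩
    push Not at hbad
    obtain ⟨j, hj, w, hw⟩ := hbad
    exact ⟨L', hL', j, Finset.mem_range.2 hj, w, Finset.mem_univ w, hw⟩
  · have e1 : s * (2 ^ l * (|D + 2| + 1) * B * √(P * Λ)) = (|D + 2| + 1) * Λ := by
      have : √(Λ / P) * √(P * Λ) = Λ := by
        rw [← Real.sqrt_mul (by positivity), show Λ / P * (P * Λ) = Λ ^ 2 by field_simp,
          Real.sqrt_sq (by linarith)]
      calc _ = (|D + 2| + 1) * (√(Λ / P) * √(P * Λ)) := by rw [hs]; field_simp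
        _ = _ := by rw [this]
    rw [e1, hs2]
    have e2 : (m : ℝ) * (Λ / P / 2) ≤ Λ := by
      have hmP : (m : ℝ) ≤ P := by exact_mod_cast hm
      calc (m : ℝ) * (Λ / P / 2) ≤ P * (Λ / P / 2) := by gcongr
        _ = Λ / 2 := by field_simp
        _ ≤ Λ := by linarith
    nlinarith [le_abs_self (D + 2)]

/-- Fluctuations by Bernstein's inequality: the increments are bounded by a constant, and their
variance is of the order of the expected count. -/
lemma repDev_tail_of_bernstein {l P m : ℕ} {B Λ D c : ℝ} (h : BijectiveNSMul G l) (hl : l ≠ 0)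
    (hP : 1 ≤ P) (hm : m ≤ P) (hB : 1 ≤ B) (hΛ : 1 ≤ Λ) (u : G) (hc : 0 < c)
    (hX : c ≤ (P : ℝ) ^ l / Fintype.card G)
    (hlow : wordProb m (LargeLowerDev (G := G) l B) ≤ Real.exp (-(D + 2) * Λ)) :
    wordProb m (fun L => (2 * (2 ^ l * B) ^ 2 + |D + 2|) * √(1 + (2 ^ l * B) ^ 2 / c) *
      √((P : ℝ) ^ l * Λ ^ (l + 1) / Fintype.card G) < |repDev l L u|) ≤ Real.exp (-D * Λ) := by
  have hPR : (1 : ℝ) ≤ P := by exact_mod_cast hP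
  have hG : (0 : ℝ) < Fintype.card G := by exact_mod_cast Fintype.card_pos
  set X : ℝ := (P : ℝ) ^ l / Fintype.card G with hXdef
  set M : ℝ := 2 ^ l * B with hM
  have hM0 : 0 < M := by positivity
  have hX0 : 0 < X := hc.trans_le hX
  set W : ℝ := X + M ^ 2 * Λ with hW
  have hW0 : 0 < W := by positivity
  -- the minimum of `√(Λ / X)` and `1 / M`, up to constants
  set s : ℝ := √(Λ / W) with hs
  have hs0 : 0 ≤ s := Real.sqrt_nonneg _
  have hs2 : s ^ 2 = Λ / W := Real.sq_sqrt (by positivity)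
  have hsM : s * M ≤ 1 := by
    rw [← abs_of_nonneg (mul_nonneg hs0 hM0.le), ← sq_le_one_iff_abs_le_one, mul_pow, hs2,
      div_mul_eq_mul_div, div_le_one hW0]
    linarith
  set V : ℝ := M * (2 ^ l * (2 * ((P : ℝ) ^ (l - 1) / Fintype.card G))) with hV
  have hPV : (P : ℝ) * V ≤ 2 * M ^ 2 * X := by
    obtain ⟨j, rfl⟩ := Nat.exists_eq_succ_of_ne_zero hl
    have e : (P : ℝ) * V = 2 * M * 2 ^ (j + 1) * X := by
      simp only [hV, hXdef, Nat.succ_eq_add_one, Nat.add_sub_cancel]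
      ring
    have : (2 : ℝ) ^ (j + 1) ≤ M := le_mul_of_one_le_right (by positivity) hB
    rw [e]
    calc 2 * M * 2 ^ (j + 1) * X ≤ 2 * M * M * X := by gcongr
      _ = _ := by ring
  have hgood : ∀ L : List G, L.length < m → (∀ j < l, ∀ w, |repDev j L w| ≤ B) →
      (𝔼 g, Real.exp (s * repDevStep l u L g) ≤ Real.exp (s ^ 2 * V)) ∧
      𝔼 g, Real.exp (s * -repDevStep l u L g) ≤ Real.exp (s ^ 2 * V) := by
    intro L hLm hL
    have hbd : ∀ g, |s * repDevStep l u L g| ≤ 1 := fun g => by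
      rw [abs_mul, abs_of_nonneg hs0]
      exact (mul_le_mul_of_nonneg_left (abs_repDevStep_le (by linarith) hL u g) hs0).trans hsM
    have hvar := expect_repDevStep_sq_le h (by linarith) hL hP (hLm.le.trans hm) u
    refine ⟨expect_exp_le_of_variance_le hbd (expect_repDevStep h u L) hvar,
      expect_exp_le_of_variance_le (f := fun g => -repDevStep l u L g)
      (fun g => by rw [mul_neg, abs_neg]; exact hbd g) ?_ (by simpa only [neg_sq] using hvar)⟩
    rw [Finset.expect_neg_distrib, expect_repDevStep h u L, neg_zero]
  set κ : ℝ := (2 * M ^ 2 + |D + 2|) * √(1 + M ^ 2 / c) *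
    √((P : ℝ) ^ l * Λ ^ (l + 1) / Fintype.card G) with hκ
  have main := wordProb_lt_abs_le_exp m (fun L => repDev l L u) (repDevStep l u)
    (fun L => ∀ j < l, ∀ w, |repDev j L w| ≤ B) (repDev_nil hl u) (fun g L => repDev_cons l g L u)
    (s := s) (κ := κ) hs0
    (fun L hLm hL => (hgood L hLm hL).1) (fun L hLm hL => (hgood L hLm hL).2)
  refine main.trans (two_mul_add_two_mul_exp_le hΛ ?_ (Real.exp_le_exp.2 ?_))
  · refine le_trans (wordProb_mono fun L _ => ?_) hlow
    rintro ⟨L', hL', hbad⟩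
    push Not at hbad
    obtain ⟨j, hj, w, hw⟩ := hbad
    exact ⟨L', hL', j, Finset.mem_range.2 hj, w, Finset.mem_univ w, hw⟩
  · have h1 : (m : ℝ) * (s ^ 2 * V) ≤ 2 * M ^ 2 * Λ := by
      have hmP : (m : ℝ) ≤ P := by exact_mod_cast hm
      have hXW : X ≤ W := by
        have : 0 ≤ M ^ 2 * Λ := by positivity
        linarith
      calc (m : ℝ) * (s ^ 2 * V) ≤ P * (s ^ 2 * V) := by gcongr
        _ = Λ / W * (P * V) := by rw [hs2]; ring
        _ ≤ Λ / W * (2 * M ^ 2 * W) := by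
            refine mul_le_mul_of_nonneg_left (hPV.trans ?_) (by positivity)
            gcongr
        _ = 2 * M ^ 2 * Λ := by field_simp
    -- `Λ * X` dominates `W` up to a constant, both when `X` and when `M ^ 2 * Λ` is the larger term
    have h2 : W ≤ Λ * X * (1 + M ^ 2 / c) := by
      have e1 : X ≤ Λ * X := le_mul_of_one_le_left hX0.le hΛ
      have e2 : M ^ 2 * Λ ≤ Λ * X * (M ^ 2 / c) := by
        have : M ^ 2 * Λ = Λ * c * (M ^ 2 / c) := by field_simp
        rw [this]
        gcongr
      rw [hW]
      linarith
    have h3 : Λ ≤ s * (√(1 + M ^ 2 / c) * √((P : ℝ) ^ l * Λ ^ (l + 1) / Fintype.card G)) := by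
      rw [hs, ← Real.sqrt_mul (by positivity), ← Real.sqrt_mul (by positivity)]
      refine Real.le_sqrt_of_sq_le ?_
      have e : (P : ℝ) ^ l * Λ ^ (l + 1) / Fintype.card G = X * Λ ^ (l + 1) := by
        rw [hXdef]; ring
      rw [e]
      calc Λ ^ 2 ≤ Λ ^ (l + 1) := pow_le_pow_right₀ hΛ (by omega)
        _ = Λ ^ (l + 1) / W * W := by field_simp
        _ ≤ Λ ^ (l + 1) / W * (Λ * X * (1 + M ^ 2 / c)) := by gcongr
        _ = _ := by ring
    have h4 : (2 * M ^ 2 + |D + 2|) * Λ ≤ s * κ := by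
      rw [hκ]
      calc _ ≤ (2 * M ^ 2 + |D + 2|) *
            (s * (√(1 + M ^ 2 / c) * √((P : ℝ) ^ l * Λ ^ (l + 1) / Fintype.card G))) := by gcongr
        _ = _ := by ring
    nlinarith [le_abs_self (D + 2)]

end Deviation

lemma largeLowerDev_prob_le {G : Type*} [AddCommGroup G] [Fintype G] {l P m : ℕ}
    {β δ Λ D B : ℝ} (hΛ : 1 ≤ Λ) (hG : (Fintype.card G : ℝ) ≤ Real.exp (δ * Λ)) (hP : 1 ≤ P)
    (hPβ : (P : ℝ) ≤ Real.exp (β * Λ)) (hm : m ≤ P)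
    (h : ∀ i ≤ m, ∀ j < l, ∀ w : G, wordProb i (fun L => B < |repDev j L w|) ≤
      Real.exp (-(D + β + 1 + l + δ) * Λ)) :
    wordProb m (LargeLowerDev (G := G) l B) ≤ Real.exp (-D * Λ) := by
  have h1 := wordProb_suffix_le m
    (fun L : List G => ∃ j ∈ Finset.range l, ∃ w ∈ Finset.univ, B < |repDev j L w|)
    (δ := Real.exp (-(D + β + 1) * Λ)) fun i hi => wordProb_exists_lt_exists_le hΛ hG (h i hi)
  refine h1.trans ?_
  have h2 : (m : ℝ) + 1 ≤ Real.exp Λ * Real.exp (β * Λ) := by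
    have hmP : (m : ℝ) ≤ P := by exact_mod_cast hm
    have hPR : (1 : ℝ) ≤ P := by exact_mod_cast hP
    have h3 : 2 ≤ Real.exp Λ := by linarith [Real.add_one_le_exp Λ]
    nlinarith
  calc ((m : ℝ) + 1) * Real.exp (-(D + β + 1) * Λ)
      ≤ Real.exp Λ * Real.exp (β * Λ) * Real.exp (-(D + β + 1) * Λ) := by gcongr
    _ = Real.exp (-D * Λ) := by
        rw [← Real.exp_add, ← Real.exp_add]; congr 1; ring

open Classical in
/-- The size of the deviations of order `l` when `P ≈ exp (β * Λ)` letters are drawn from a group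
of order `exp (δ * Λ)`. -/
def devScale (β δ : ℝ) (l P : ℕ) (Λ : ℝ) : ℝ :=
  if l * β < δ then 1 else √((P : ℝ) ^ l * Λ ^ (l + 1) / Real.exp (δ * Λ))

/-- Deviations of order `l` are `O (devScale β δ l P Λ)` except with very small probability. The
proof is by induction on `l`: up to the first `l` with `δ ≤ l * β` the deviations of lower order
are bounded, and the Bernstein bound applies; from there on Hoeffding's bound is good enough and
costs a factor `√Λ` for each step. -/
theorem exists_repDev_tail (β δ : ℝ) (hβ : 0 < β) (hδ : 0 < δ) (l : ℕ) : ∀ D : ℝ,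
    ∃ K : ℝ, 1 ≤ K ∧ ∀ (G : Type) [AddCommGroup G] [Fintype G] (Λ : ℝ) (P m : ℕ) (u : G),
      1 ≤ Λ → (Fintype.card G : ℝ) = Real.exp (δ * Λ) → BijectiveNSMul G l →
      Real.exp (β * Λ) ≤ 2 * P → (P : ℝ) ≤ Real.exp (β * Λ) → 1 ≤ P → m ≤ P →
      wordProb m (fun L => K * devScale β δ l P Λ < |repDev l L u|) ≤ Real.exp (-D * Λ) := by
  induction l using Nat.strong_induction_on with
  | _ l ih =>
  intro D
  by_cases hcase : l * β < δ
  · obtain ⟨K, hK1, hK⟩ := exists_setCount_tail_of_small l 1 1 (δ - l * β) δ D zero_le_one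
      zero_le_one (by linarith)
    refine ⟨K + 1, by linarith, fun G _ _ Λ P m u hΛ hG hbij _ hPβ hP hm => ?_⟩
    have hX : (P : ℝ) ^ l / Fintype.card G ≤ Real.exp (-(δ - l * β) * Λ) := by
      rw [hG, div_le_iff₀ (Real.exp_pos _), ← Real.exp_add]
      refine (pow_le_pow_left₀ (Nat.cast_nonneg _) hPβ l).trans_eq ?_
      rw [← Real.exp_nat_mul]; congr 1; ring
    refine le_trans (wordProb_mono fun L hL => ?_) (hK G Λ P m {u} 0 hΛ hG.le hbij.fiberBound hP hm
      (by simpa using hX))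
    rw [devScale, if_pos hcase, mul_one, setCount_singleton]
    intro h
    have h1 := abs_repDev_le l L u
    have h2 : (L.length : ℝ) ^ l / Fintype.card G ≤ 1 := by
      calc (L.length : ℝ) ^ l / Fintype.card G ≤ (P : ℝ) ^ l / Fintype.card G := by
            gcongr; exact hL.trans_le hm
        _ ≤ Real.exp (-(δ - l * β) * Λ) := hX
        _ ≤ 1 := Real.exp_le_one_iff.2 (by nlinarith)
    linarith
  have hl : l ≠ 0 := by
    rintro rfl
    exact hcase (by simpa using hδ)
  have ih' : ∀ j : Fin l, _ := fun j => ih j j.2 (D + 2 + β + 1 + l + δ)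
  choose K hK1 hK using ih'
  set S : ℝ := 1 + ∑ j, K j with hS
  have hS1 : 1 ≤ S := by
    have : 0 ≤ ∑ j, K j := Finset.sum_nonneg fun j _ => zero_le_one.trans (hK1 j)
    linarith
  have hKS : ∀ j, K j ≤ S := fun j => by
    have := Finset.single_le_sum (fun i _ => zero_le_one.trans (hK1 i)) (Finset.mem_univ j)
    linarith
  -- a common bound for all deviations of lower order, in terms of a bound for their scales
  have low : ∀ (G : Type) [AddCommGroup G] [Fintype G] (Λ : ℝ) (P m : ℕ) (Y : ℝ), 0 ≤ Y →
      1 ≤ Λ → (Fintype.card G : ℝ) = Real.exp (δ * Λ) → BijectiveNSMul G l →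
      Real.exp (β * Λ) ≤ 2 * P → (P : ℝ) ≤ Real.exp (β * Λ) → 1 ≤ P → m ≤ P →
      (∀ j < l, devScale β δ j P Λ ≤ Y) →
      wordProb m (LargeLowerDev (G := G) l (S * Y)) ≤ Real.exp (-(D + 2) * Λ) := by
    intro G _ _ Λ P m Y hY hΛ hG hbij hPβ' hPβ hP hm hYj
    refine largeLowerDev_prob_le hΛ hG.le hP hPβ hm fun i hi j hj w => ?_
    refine le_trans (wordProb_mono fun L _ h => ?_)
      (hK ⟨j, hj⟩ G Λ P i w hΛ hG (hbij.mono hj.le) hPβ' hPβ hP (hi.trans hm))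
    refine lt_of_le_of_lt ?_ h
    calc K ⟨j, hj⟩ * devScale β δ j P Λ ≤ K ⟨j, hj⟩ * Y :=
          mul_le_mul_of_nonneg_left (hYj j hj) (zero_le_one.trans (hK1 _))
      _ ≤ S * Y := mul_le_mul_of_nonneg_right (hKS _) hY
  -- the expected counts in the range `δ ≤ j * β` are bounded from below
  have below : ∀ (Λ : ℝ) (P j : ℕ), 1 ≤ Λ → Real.exp (β * Λ) ≤ 2 * P → δ ≤ j * β →
      1 ≤ 2 ^ j * ((P : ℝ) ^ j / Real.exp (δ * Λ)) := by
    intro Λ P j hΛ hPβ' hj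
    rw [← mul_div_assoc, one_le_div (Real.exp_pos _), ← mul_pow]
    calc Real.exp (δ * Λ) ≤ Real.exp (j * (β * Λ)) := Real.exp_le_exp.2 (by nlinarith)
      _ = Real.exp (β * Λ) ^ j := Real.exp_nat_mul _ _
      _ ≤ _ := pow_le_pow_left₀ (Real.exp_pos _).le hPβ' j
  by_cases hprev : (l - 1 : ℕ) * β < δ
  · refine ⟨1 + (2 * (2 ^ l * S) ^ 2 + |D + 2|) * √(1 + (2 ^ l * S) ^ 2 / (1 / 2 ^ l)), ?_,
      fun G _ _ Λ P m u hΛ hG hbij hPβ' hPβ hP hm => ?_⟩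
    · have : 0 ≤ (2 * (2 ^ l * S) ^ 2 + |D + 2|) * √(1 + (2 ^ l * S) ^ 2 / (1 / 2 ^ l)) := by
        positivity
      linarith
    have hlow := low G Λ P m 1 zero_le_one hΛ hG hbij hPβ' hPβ hP hm fun j hj => by
      have : (j : ℝ) ≤ (l - 1 : ℕ) := by exact_mod_cast Nat.le_sub_one_of_lt hj
      rw [devScale, if_pos (by nlinarith)]
    rw [mul_one] at hlow
    have hX : 1 / 2 ^ l ≤ (P : ℝ) ^ l / Fintype.card G := by
      rw [hG, div_le_iff₀ (by positivity), mul_comm]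
      exact below Λ P l hΛ hPβ' (not_lt.1 hcase)
    refine le_trans (wordProb_mono fun L _ h => ?_)
      (repDev_tail_of_bernstein hbij hl hP hm hS1 hΛ u (c := 1 / 2 ^ l) (by positivity) hX hlow)
    refine lt_of_le_of_lt ?_ h
    rw [devScale, if_neg hcase, hG]
    exact mul_le_mul_of_nonneg_right (by linarith) (Real.sqrt_nonneg _)
  · refine ⟨1 + 2 ^ l * (|D + 2| + 1) * (S * 2 ^ l), ?_,
      fun G _ _ Λ P m u hΛ hG hbij hPβ' hPβ hP hm => ?_⟩
    · have : 0 ≤ 2 ^ l * (|D + 2| + 1) * (S * 2 ^ l) := by positivity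
      linarith
    have hPR : (1 : ℝ) ≤ P := by exact_mod_cast hP
    obtain ⟨i, rfl⟩ := Nat.exists_eq_succ_of_ne_zero hl
    simp only [Nat.succ_eq_add_one, Nat.add_sub_cancel] at *
    set Y : ℝ := √((P : ℝ) ^ i * Λ ^ (i + 1) / Real.exp (δ * Λ)) with hY
    have hYlow : 1 ≤ 2 ^ (i + 1) * Y := by
      have h1 := below Λ P i hΛ hPβ' (not_lt.1 hprev)
      have h2 : 1 ≤ (2 ^ (i + 1)) ^ 2 * ((P : ℝ) ^ i * Λ ^ (i + 1) / Real.exp (δ * Λ)) := by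
        calc 1 ≤ 2 ^ i * ((P : ℝ) ^ i / Real.exp (δ * Λ)) := h1
          _ ≤ (2 ^ (i + 1)) ^ 2 * (Λ ^ (i + 1) * ((P : ℝ) ^ i / Real.exp (δ * Λ))) := by
              have e1 : (2 : ℝ) ^ i ≤ (2 ^ (i + 1)) ^ 2 := by
                rw [← pow_mul]; exact pow_le_pow_right₀ one_le_two (by omega)
              have e2 : (1 : ℝ) ≤ Λ ^ (i + 1) := one_le_pow₀ hΛ
              have e3 : 0 ≤ (P : ℝ) ^ i / Real.exp (δ * Λ) := by positivity
              exact mul_le_mul e1 (le_mul_of_one_le_left e3 e2) e3 (by positivity)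
          _ = _ := by ring
      have h3 := Real.sqrt_le_sqrt h2
      rwa [Real.sqrt_one, Real.sqrt_mul (by positivity), Real.sqrt_sq (by positivity)] at h3
    have hY0 : 0 < Y := by
      by_contra hneg
      have : (2 : ℝ) ^ (i + 1) * Y ≤ 0 := mul_nonpos_of_nonneg_of_nonpos (by positivity)
        (not_lt.1 hneg)
      linarith
    have hlow := low G Λ P m (2 ^ (i + 1) * Y) (by positivity) hΛ hG hbij hPβ' hPβ hP hm
      fun j hj => by
        rw [devScale]
        split_ifs
        · exact hYlow
        · refine le_trans (Real.sqrt_le_sqrt ?_)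
            (le_mul_of_one_le_left hY0.le (one_le_pow₀ one_le_two))
          have hji : j ≤ i := Nat.lt_succ_iff.1 hj
          gcongr
    refine le_trans (wordProb_mono fun L _ h => ?_)
      (repDev_tail_of_hoeffding hbij hl hP hm (B := S * (2 ^ (i + 1) * Y)) (by positivity) hΛ u
        hlow)
    refine lt_of_le_of_lt ?_ h
    have e : √((P : ℝ) ^ (i + 1) * Λ ^ (i + 1 + 1) / Real.exp (δ * Λ)) = Y * √(P * Λ) := by
      rw [hY, ← Real.sqrt_mul (by positivity)]
      congr 1
      ring
    rw [devScale, if_neg hcase, e]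
    calc 2 ^ (i + 1) * (|D + 2| + 1) * (S * (2 ^ (i + 1) * Y)) * √(P * Λ)
        = 2 ^ (i + 1) * (|D + 2| + 1) * (S * 2 ^ (i + 1)) * (Y * √(P * Λ)) := by ring
      _ ≤ _ := mul_le_mul_of_nonneg_right (by linarith) (by positivity)

/-! ### Character sums over random words -/

lemma wordProb_lt_abs_sum_le {G : Type*} [Fintype G] [Nonempty G] {f : G → ℝ}
    (hf : ∀ g, |f g| ≤ 1) (hf0 : 𝔼 g, f g = 0) {P : ℕ} (hP : 1 ≤ P) {Λ D : ℝ} (hΛ : 1 ≤ Λ) :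
    wordProb P (fun L => (|D + 2| + 1) * √(P * Λ) < |(L.map f).sum|) ≤ Real.exp (-D * Λ) := by
  have hPR : (0 : ℝ) < P := by exact_mod_cast hP
  have hs2 : √(Λ / P) ^ 2 = Λ / P := Real.sq_sqrt (by positivity)
  have main := wordProb_lt_abs_le_exp P (fun L : List G => (L.map f).sum) (fun _ g => f g)
    (fun _ => True) rfl (fun g L => by simp [add_comm]) (s := √(Λ / P))
    (κ := (|D + 2| + 1) * √(P * Λ)) (Real.sqrt_nonneg _)
    (fun _ _ _ => expect_exp_le_of_abs_le hf hf0 _)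
    (fun _ _ _ => expect_exp_le_of_abs_le (f := fun g => -f g) (by simpa using hf)
      (by rw [Finset.expect_neg_distrib, hf0, neg_zero]) _)
  refine main.trans (two_mul_add_two_mul_exp_le hΛ ?_ (Real.exp_le_exp.2 ?_))
  · rw [wordProb_false (by simp)]
    exact (Real.exp_pos _).le
  · have e : √(Λ / P) * ((|D + 2| + 1) * √(P * Λ)) = (|D + 2| + 1) * Λ := by
      rw [mul_left_comm, ← Real.sqrt_mul (by positivity),
        show Λ / P * (P * Λ) = Λ ^ 2 by field_simp, Real.sqrt_sq (by linarith)]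
    rw [e, hs2, show (P : ℝ) * (Λ / P * 1 ^ 2 / 2) = Λ / 2 by field_simp]
    nlinarith [le_abs_self (D + 2)]

/-- Sums of a nontrivial character over `P` random letters show square-root cancellation. -/
lemma wordProb_lt_norm_charSum_le {G : Type*} [AddCommGroup G] [Fintype G] {ψ : AddChar G ℂ}
    (hψ : ψ ≠ 0) {P : ℕ} (hP : 1 ≤ P) {Λ D : ℝ} (hΛ : 1 ≤ Λ) :
    wordProb P (fun L => 2 * ((|D + 3| + 1) * √(P * Λ)) < ‖(L.map ψ).sum‖) ≤
      Real.exp (-D * Λ) := by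
  have h0 := AddChar.sum_eq_zero_iff_ne_zero.2 hψ
  have hre0 : 𝔼 g, (ψ g).re = 0 := by
    rw [Fintype.expect_eq_sum_div_card, ← Complex.re_sum, h0, Complex.zero_re, zero_div]
  have him0 : 𝔼 g, (ψ g).im = 0 := by
    rw [Fintype.expect_eq_sum_div_card, ← Complex.im_sum, h0, Complex.zero_im, zero_div]
  have hre : ∀ L : List G, (L.map fun g => (ψ g).re).sum = ((L.map ψ).sum).re := fun L => by
    induction L with
    | nil => simp
    | cons g L ih => simp [ih]
  have him : ∀ L : List G, (L.map fun g => (ψ g).im).sum = ((L.map ψ).sum).im := fun L => by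
    induction L with
    | nil => simp
    | cons g L ih => simp [ih]
  have h1 := wordProb_lt_abs_sum_le (f := fun g => (ψ g).re) (D := D + 1)
    (fun g => (Complex.abs_re_le_norm _).trans_eq (ψ.norm_apply g)) hre0 hP hΛ
  have h2 := wordProb_lt_abs_sum_le (f := fun g => (ψ g).im) (D := D + 1)
    (fun g => (Complex.abs_im_le_norm _).trans_eq (ψ.norm_apply g)) him0 hP hΛ
  rw [show D + 1 + 2 = D + 3 by ring] at h1 h2
  refine le_trans (wordProb_mono fun L _ h => ?_) ((wordProb_or_le P _ _).trans
    ((add_le_add h1 h2).trans (exp_add_exp_le hΛ)))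
  rw [hre, him]
  by_contra! hcon
  linarith [Complex.norm_le_abs_re_add_abs_im (L.map ψ).sum]

/-! ### The grid as a finite group -/

section Grid

variable {N d : ℕ} [NeZero N]

/-- The embedding of `(ℤ/N)^d` into the torus, with image the grid. -/
def gridHom (N d : ℕ) [NeZero N] : (Fin d → ZMod N) →+ Torus d :=
  (ZMod.toAddCircle (N := N)).compLeft (Fin d)

lemma gridHom_apply (g : Fin d → ZMod N) (i : Fin d) :
    gridHom N d g i = ZMod.toAddCircle (g i) := rfl

lemma gridHom_injective : Function.Injective (gridHom N d) := fun _ _ hgh =>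
  funext fun i => ZMod.toAddCircle_injective N (congrFun hgh i)

lemma gridHom_mem_grid (g : Fin d → ZMod N) : gridHom N d g ∈ grid N d := fun i =>
  ⟨(g i).val, ZMod.val_lt _, by rw [gridHom_apply, ZMod.toAddCircle_apply]⟩

lemma exists_gridHom_eq {x : Torus d} (hx : x ∈ grid N d) : ∃ g, gridHom N d g = x := by
  choose k _ hk using hx
  exact ⟨fun i => (k i : ZMod N), funext fun i => by
    rw [gridHom_apply, ZMod.toAddCircle_natCast, hk i]⟩

lemma card_pi_zmod : Fintype.card (Fin d → ZMod N) = N ^ d := by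
  simp [ZMod.card]

lemma fiberBound_zmod (l : ℕ) : FiberBound (Fin d → ZMod N) l ((l : ℝ) ^ d) := by
  classical
  intro k hk hkl w
  have hker : (Finset.univ.filter fun x : ZMod N => k • x = 0).card ≤ k := by
    convert IsAddCyclic.card_nsmul_eq_zero_le (α := ZMod N) (n := k) hk
  have hle : (Finset.univ.filter fun g : Fin d → ZMod N => k • g = w).card ≤
      (Fintype.piFinset fun _ : Fin d =>
        Finset.univ.filter fun x : ZMod N => k • x = 0).card := by
    rcases (Finset.univ.filter fun g : Fin d → ZMod N => k • g = w).eq_empty_or_nonempty with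
      he | ⟨g₀, hg₀⟩
    · rw [he]; exact Nat.zero_le _
    · refine Finset.card_le_card_of_injOn (fun g => g - g₀) (fun g hg => ?_)
        (sub_left_injective.injOn)
      have h1 : k • g = w := by simpa using hg
      have h2 : k • g₀ = w := by simpa using hg₀
      have h3 : k • (g - g₀) = 0 := by rw [smul_sub, h1, h2, sub_self]
      simp only [Finset.mem_coe, Fintype.mem_piFinset, Finset.mem_filter, Finset.mem_univ, true_and]
      exact fun i => congrFun h3 i
  rw [Fintype.card_piFinset_const] at hle
  calc _ ≤ (((Finset.univ.filter fun x : ZMod N => k • x = 0).card ^ d : ℕ) : ℝ) := by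
        refine Nat.cast_le.2 (le_trans (le_of_eq ?_) hle)
        congr 1
        ext
        simp
    _ ≤ (l : ℝ) ^ d := by
        push_cast
        gcongr
        exact_mod_cast hker.trans hkl

lemma bijectiveNSMul_zmod {n l : ℕ} (hN : Nat.gcd n.factorial N = 1) (hl : l ≤ n) :
    BijectiveNSMul (Fin d → ZMod N) l := by
  intro k hk hkl
  have hu : IsUnit (k : ZMod N) := (ZMod.isUnit_iff_coprime k N).2
    (Nat.Coprime.coprime_dvd_left (Nat.dvd_factorial hk (hkl.trans hl)) hN)
  rw [Fintype.bijective_iff_injective_and_card]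
  refine ⟨fun g h hgh => funext fun i => ?_, rfl⟩
  have := congrFun hgh i
  simp only [Pi.smul_apply, nsmul_eq_mul] at this
  exact hu.mul_left_cancel this

/-! ### Cubes and boxes -/

lemma volume_coe_image_Icc_ge {a x y : ℝ} (hx : a ≤ x) (hy : y < a + 1) :
    y - x ≤ (volume : Measure UnitAddCircle).real
      ((fun t : ℝ => (t : UnitAddCircle)) '' Set.Icc x y) := by
  rcases lt_or_ge y x with h | hxy
  · exact (by linarith : y - x ≤ 0).trans measureReal_nonneg
  have hm : MeasurableSet ((fun t : ℝ => (t : UnitAddCircle)) '' Set.Icc x y) :=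
    (isCompact_Icc.image (AddCircle.continuous_mk' 1)).measurableSet
  have h1 := AddCircle.add_projection_respects_measure (T := 1) a hm
  have h2 : ENNReal.ofReal (y - x) ≤
      volume ((fun t : ℝ => (t : UnitAddCircle)) '' Set.Icc x y) := by
    rw [h1, ← Real.volume_Ioc]
    refine measure_mono fun t ht => ⟨⟨t, Set.Ioc_subset_Icc_self ht, rfl⟩, ?_, ?_⟩
    · exact hx.trans_lt ht.1
    · exact ht.2.trans hy.le
  have h3 := ENNReal.toReal_mono (measure_ne_top _ _) h2
  rwa [ENNReal.toReal_ofReal (by linarith)] at h3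

/-- The points of `ℤ/N` in an arc of length at most `w` are contained in an arithmetic interval of
`⌊N * w⌋ + 1` points. -/
lemma exists_interval_of_isConnected {J : Set UnitAddCircle} (hJ : IsConnected J) {w : ℝ}
    (hw : (volume : Measure UnitAddCircle).real J ≤ w) :
    ∃ c : ZMod N, ∀ g : ZMod N, ZMod.toAddCircle g ∈ J → ∃ i < ⌊N * w⌋₊ + 1, g = c + (i : ℕ) := by
  have hN : (0 : ℝ) < N := Nat.cast_pos.2 (NeZero.pos N)
  by_cases hJu : J = Set.univ
  · refine ⟨0, fun g _ => ⟨g.val, ?_, by simp⟩⟩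
    have h1 : (1 : ℝ) ≤ w := by
      have : (volume : Measure UnitAddCircle).real J = 1 := by
        rw [hJu, measureReal_def, UnitAddCircle.measure_univ, ENNReal.toReal_one]
      rwa [this] at hw
    refine (ZMod.val_lt g).trans_le (Nat.le_succ_of_le (Nat.le_floor ?_))
    nlinarith
  obtain ⟨p, hp⟩ := (Set.ne_univ_iff_exists_notMem J).1 hJu
  obtain ⟨a, rfl⟩ := QuotientAddGroup.mk_surjective p
  -- cut the circle at a point outside of `J`
  set e : UnitAddCircle → ℝ := fun x => (AddCircle.equivIco 1 a x : ℝ) with he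
  have hcoe : ∀ x, ((e x : ℝ) : UnitAddCircle) = x := fun x =>
    (AddCircle.equivIco 1 a).symm_apply_apply x
  have hmem : ∀ x, e x ∈ Set.Ico a (a + 1) := fun x => (AddCircle.equivIco 1 a x).2
  have hcont : ContinuousOn e J := continuousOn_of_forall_continuousAt fun x hx =>
    continuousAt_subtype_val.comp (AddCircle.continuousAt_equivIco 1 a fun h => hp (h ▸ hx))
  have hord : (e '' J).OrdConnected :=
    isPreconnected_iff_ordConnected.1 (hJ.isPreconnected.image e hcont)
  have lift : ∀ g : ZMod N, ZMod.toAddCircle g ∈ J →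
      ∃ z : ℤ, (z / N : ℝ) ∈ e '' J ∧ (z : ZMod N) = g := by
    intro g hg
    have h1 : ((e (ZMod.toAddCircle g) : ℝ) : UnitAddCircle) =
        ((g.val / N : ℝ) : UnitAddCircle) := by
      rw [hcoe, ZMod.toAddCircle_apply]
    rw [← sub_eq_zero, ← AddCircle.coe_sub, AddCircle.coe_eq_zero_iff] at h1
    obtain ⟨k, hk⟩ := h1
    have h2 : e (ZMod.toAddCircle g) = ((g.val + N * k : ℤ) : ℝ) / N := by
      rw [zsmul_one, eq_sub_iff_add_eq] at hk
      rw [← hk]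
      push_cast
      field_simp
      ring
    exact ⟨g.val + N * k, ⟨_, hg, h2⟩, by simp⟩
  by_cases hI : ∃ z : ℤ, (z / N : ℝ) ∈ e '' J
  · have hbdd : ∃ b : ℤ, ∀ z : ℤ, (z / N : ℝ) ∈ e '' J → b ≤ z := by
      refine ⟨⌊a * N⌋, fun z ⟨x, _, hx⟩ => ?_⟩
      have : a ≤ z / N := hx ▸ (hmem x).1
      rw [le_div_iff₀ hN] at this
      exact_mod_cast (Int.floor_le (a * N)).trans this
    obtain ⟨z₀, hz₀, hmin⟩ := Int.exists_least_of_bdd hbdd hI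
    refine ⟨(z₀ : ZMod N), fun g hg => ?_⟩
    obtain ⟨z, hz, rfl⟩ := lift g hg
    have hzz := hmin z hz
    have hsub : (fun t : ℝ => (t : UnitAddCircle)) '' Set.Icc (z₀ / N : ℝ) (z / N) ⊆ J := by
      rintro _ ⟨t, ht, rfl⟩
      obtain ⟨x, hx, rfl⟩ := hord.out hz₀ hz ht
      simpa only [hcoe] using hx
    obtain ⟨x₀, -, hx₀⟩ := hz₀
    obtain ⟨x₁, -, hx₁⟩ := hz
    have hvol := (volume_coe_image_Icc_ge (hx₀ ▸ (hmem x₀).1) (hx₁ ▸ (hmem x₁).2)).trans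
      ((measureReal_mono hsub).trans hw)
    refine ⟨(z - z₀).toNat, Nat.lt_succ_of_le (Nat.le_floor ?_), ?_⟩
    · have h1 : (((z - z₀).toNat : ℤ) : ℝ) = z - z₀ := by
        rw [Int.toNat_of_nonneg (by omega)]; push_cast; rfl
      rw [← Int.cast_natCast, h1]
      rw [← sub_div, div_le_iff₀ hN] at hvol
      linarith
    · have h1 : (((z - z₀).toNat : ℤ) : ZMod N) = z - z₀ := by
        rw [Int.toNat_of_nonneg (by omega)]; push_cast; rfl
      rw [← Int.cast_natCast, h1]
      ring
  · exact ⟨0, fun g hg => absurd ((lift g hg).imp fun z hz => hz.1) hI⟩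

/-- The box `{0, …, m - 1}^d` in `(ℤ/N)^d`. -/
def box (N d m : ℕ) : Finset (Fin d → ZMod N) :=
  Fintype.piFinset fun _ => (Finset.range m).image fun i : ℕ => (i : ZMod N)

omit [NeZero N] in
lemma card_box_le (m : ℕ) : (box N d m).card ≤ m ^ d := by
  rw [box, Fintype.card_piFinset_const]
  exact Nat.pow_le_pow_left (Finset.card_image_le.trans_eq (Finset.card_range m)) d

open Classical in
/-- The grid points of a set, as elements of `(ℤ/N)^d`. -/
def gridPoints (N : ℕ) [NeZero N] (Q : Set (Torus d)) : Finset (Fin d → ZMod N) :=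
  Finset.univ.filter fun g => gridHom N d g ∈ Q

/-- The grid points of a cube lie in a translate of a box, the size of which depends on the volume
of the cube only. -/
lemma exists_box_of_isCube (hd : d ≠ 0) {Q : Set (Torus d)} (hQ : IsCube Q) {w : ℝ} (hw : 0 ≤ w)
    (hvol : (volume : Measure (Torus d)).real Q ≤ w ^ d) :
    ∃ c : Fin d → ZMod N, ∀ g ∈ gridPoints N Q, g - c ∈ box N d (⌊N * w⌋₊ + 1) := by
  obtain ⟨J, hJ, hJvol, rfl⟩ := hQ
  have hJw : ∀ i, (volume : Measure UnitAddCircle).real (J i) ≤ w := fun i => by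
    have h1 : (volume : Measure (Torus d)).real (Set.pi Set.univ J) =
        (volume : Measure UnitAddCircle).real (J i) ^ d := by
      rw [measureReal_def, volume_pi_pi, measureReal_def,
        Finset.prod_congr rfl fun j _ => hJvol j i,
        Finset.prod_const, Finset.card_univ, Fintype.card_fin, ENNReal.toReal_pow]
    rw [h1] at hvol
    exact le_of_pow_le_pow_left₀ hd hw hvol
  choose c hc using fun i => exists_interval_of_isConnected (N := N) (hJ i) (hJw i)
  refine ⟨c, fun g hg => ?_⟩
  have hg' : gridHom N d g ∈ Set.pi Set.univ J := by simpa [gridPoints] using hg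
  refine Fintype.mem_piFinset.2 fun i => ?_
  obtain ⟨t, ht, hgt⟩ := hc i (g i) (hg' i (Set.mem_univ i))
  refine Finset.mem_image.2 ⟨t, Finset.mem_range.2 ht, ?_⟩
  rw [Pi.sub_apply, hgt, add_sub_cancel_left]

omit [NeZero N] in
lemma setCount_le_of_sub_mem {l : ℕ} {L : List (Fin d → ZMod N)} {A A' : Finset (Fin d → ZMod N)}
    {c : Fin d → ZMod N} (h : ∀ g ∈ A, g - c ∈ A') : setCount l L A 0 ≤ setCount l L A' (-c) := by
  classical
  have h1 : setCount l L A 0 = ∑ a ∈ A.image (· - c), (repCount l L (a - -c) : ℝ) := by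
    rw [Finset.sum_image sub_left_injective.injOn]
    simp [setCount]
  rw [h1]
  refine Finset.sum_le_sum_of_subset_of_nonneg (fun a ha => ?_) fun _ _ _ => Nat.cast_nonneg _
  obtain ⟨g, hg, rfl⟩ := Finset.mem_image.1 ha
  exact h g hg

end Grid

/-! ### Convolution powers and Fourier transforms of averaged point masses -/

section Measures

variable {G : Type*} [AddCommGroup G] [Fintype G] {d : ℕ}

/-- The measure on the torus that has mass `f u` at `φ u`. -/
def pushCount (φ : G →+ Torus d) (f : AddMonoidAlgebra ℕ G) : Measure (Torus d) :=
  ∑ u, (f.coeff u : ENNReal) • Measure.dirac (φ u)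

instance (φ : G →+ Torus d) (f : AddMonoidAlgebra ℕ G) : SFinite (pushCount φ f) :=
  Finset.sum_induction _ SFinite (fun _ _ _ _ => inferInstance) inferInstance
    fun _ _ => inferInstance

lemma pushCount_zero (φ : G →+ Torus d) : pushCount φ 0 = 0 := by
  simp [pushCount]

lemma pushCount_add (φ : G →+ Torus d) (f f' : AddMonoidAlgebra ℕ G) :
    pushCount φ (f + f') = pushCount φ f + pushCount φ f' := by
  simp [pushCount, add_smul, Finset.sum_add_distrib]

lemma pushCount_one (φ : G →+ Torus d) : pushCount φ 1 = Measure.dirac 0 := by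
  classical
  rw [pushCount, Finset.sum_eq_single 0]
  · simp
  · intro u _ hu
    simp [AddMonoidAlgebra.one_def, hu.symm]
  · simp

lemma pushCount_single_mul (φ : G →+ Torus d) (g : G) (f : AddMonoidAlgebra ℕ G) :
    pushCount φ (AddMonoidAlgebra.single g 1 * f) =
      (Measure.dirac (φ g)).conv (pushCount φ f) := by
  have hm : Measurable fun t : Torus d => φ g + t := measurable_const_add _
  rw [Measure.dirac_conv, ← Measure.mapₗ_apply_of_measurable hm, pushCount, pushCount, map_sum]
  refine (Fintype.sum_equiv (Equiv.addLeft g) _ _ fun u => ?_).symm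
  rw [map_smul, Measure.mapₗ_apply_of_measurable hm, Measure.map_dirac' hm,
    AddMonoidAlgebra.coeff_single_mul_apply]
  simp

lemma pushCount_wordSum_mul (φ : G →+ Torus d) (L : List G) (f : AddMonoidAlgebra ℕ G) :
    pushCount φ (wordSum L * f) =
      ((L.map fun g => Measure.dirac (φ g)).sum).conv (pushCount φ f) := by
  have hfin : ∀ L : List G, SFinite (L.map fun g => Measure.dirac (φ g)).sum := fun L => by
    induction L with
    | nil => rw [List.map_nil, List.sum_nil]; infer_instance
    | cons g L ih => rw [List.map_cons, List.sum_cons]; infer_instance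
  induction L with
  | nil => simp [wordSum, pushCount_zero]
  | cons g L ih =>
    have := hfin L
    rw [List.map_cons, List.sum_cons, Measure.add_conv, ← ih, ← pushCount_single_mul,
      ← pushCount_add, ← add_mul]
    rfl

omit [Fintype G] in
lemma pointMassAverage_eq (φ : G →+ Torus d) (L : List G) :
    pointMassAverage (fun j : Fin L.length => φ L[j]) =
      (L.length : ENNReal)⁻¹ • (L.map fun g => Measure.dirac (φ g)).sum := by
  rw [pointMassAverage, ← Fin.sum_univ_fun_getElem]
  rfl

lemma convPow_pointMassAverage (φ : G →+ Torus d) (L : List G) (l : ℕ) :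
    convPow (pointMassAverage fun j : Fin L.length => φ L[j]) l =
      ((L.length : ENNReal)⁻¹) ^ l • pushCount φ (wordSum L ^ l) := by
  induction l with
  | zero => simp [convPow, pushCount_one]
  | succ l ih =>
    rw [convPow, ih, pointMassAverage_eq, Measure.conv_smul_right, Measure.conv_smul_left,
      ← pushCount_wordSum_mul, smul_smul, ← pow_succ, ← pow_succ']

open Classical in
/-- The convolution powers count representations. -/
lemma convPow_real_eq (φ : G →+ Torus d) (L : List G) (l : ℕ) (Q : Set (Torus d)) :
    (convPow (pointMassAverage fun j : Fin L.length => φ L[j]) l).real Q =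
      setCount l L (Finset.univ.filter fun g => φ g ∈ Q) 0 / (L.length : ℝ) ^ l := by
  rw [convPow_pointMassAverage, measureReal_def, Measure.smul_apply, smul_eq_mul,
    ENNReal.toReal_mul, ENNReal.toReal_pow, ENNReal.toReal_inv, ENNReal.toReal_natCast, inv_pow,
    div_eq_inv_mul]
  congr 1
  rw [pushCount, Measure.finsetSum_apply, ENNReal.toReal_sum, setCount, Finset.sum_filter]
  · refine Finset.sum_congr rfl fun u _ => ?_
    rw [Measure.smul_apply, smul_eq_mul, Measure.dirac_apply]
    by_cases hu : φ u ∈ Q <;> simp [hu, repCount]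
  · intro u _
    rw [Measure.smul_apply, smul_eq_mul]
    exact ENNReal.mul_ne_top (ENNReal.natCast_ne_top _) (measure_ne_top _ _)

omit [Fintype G] in
lemma norm_fourierTransform_pointMassAverage (φ : G →+ Torus d) (L : List G) (k : Fin d → ℤ) :
    ‖fourierTransform (pointMassAverage fun j : Fin L.length => φ L[j]) k‖ =
      ‖(L.map fun g => UnitAddTorus.mFourier (-k) (φ g)).sum‖ / L.length := by
  rw [fourierTransform, pointMassAverage, integral_smul_measure, integral_finsetSum_measure]
  · simp only [integral_dirac, ← Fin.sum_univ_fun_getElem]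
    rw [norm_smul]
    simp [div_eq_inv_mul]
  · intro j _
    exact integrable_dirac (by simp)

end Measures

section Fourier

variable {N d : ℕ} [NeZero N]

/-- The restriction of the character `t ↦ e^{-2πi k·t}` of the torus to the grid. -/
def gridChar (N : ℕ) [NeZero N] {d : ℕ} (k : Fin d → ℤ) : AddChar (Fin d → ZMod N) ℂ where
  toFun g := UnitAddTorus.mFourier (-k) (gridHom N d g)
  map_zero_eq_one' := by simp [UnitAddTorus.mFourier]
  map_add_eq_mul' g h := by
    simp [UnitAddTorus.mFourier, fourier_apply, smul_add, AddCircle.toCircle_add,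
      Finset.prod_mul_distrib]

lemma gridChar_apply (k : Fin d → ℤ) (g : Fin d → ZMod N) :
    gridChar N k g = UnitAddTorus.mFourier (-k) (gridHom N d g) := rfl

lemma gridChar_ne_zero {k : Fin d → ℤ} {r : Torus d} (hr : r ≠ 0)
    (hk : ∀ i, r i = (((k i : ℝ) / (N : ℝ) : ℝ) : UnitAddCircle)) : gridChar N k ≠ 0 := by
  classical
  intro h
  refine hr (funext fun i => ?_)
  have h1 : gridChar N k (Pi.single i 1) = 1 := by rw [h]; rfl
  have h2 : gridChar N k (Pi.single i 1) =
      fourier (-k i) (ZMod.toAddCircle (1 : ZMod N)) := by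
    rw [gridChar_apply, UnitAddTorus.mFourier]
    change ∏ j, fourier ((-k) j) (gridHom N d (Pi.single i 1) j) = _
    rw [Finset.prod_eq_single i]
    · simp [gridHom_apply]
    · intro j _ hj
      simp [gridHom_apply, Pi.single_eq_of_ne hj]
    · simp
  rw [h2, fourier_apply] at h1
  have h3 : AddCircle.toCircle (-k i • ZMod.toAddCircle (1 : ZMod N)) =
      AddCircle.toCircle (0 : AddCircle (1 : ℝ)) := by
    rw [AddCircle.toCircle_zero]
    exact Circle.coe_eq_one.1 h1
  have h4 := AddCircle.injective_toCircle one_ne_zero h3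
  rw [neg_smul, neg_eq_zero, ← map_zsmul, zsmul_one, ZMod.toAddCircle_intCast] at h4
  rw [hk i, h4]
  rfl

end Fourier

/-! ### Random grid points -/

lemma wordProb_charSum_le (N d : ℕ) [NeZero N] {P : ℕ} (hP : 1 ≤ P) {Λ : ℝ} (hΛ : 1 ≤ Λ)
    (hN : (N : ℝ) = Real.exp Λ) :
    wordProb P (fun L : List (Fin d → ZMod N) => ∃ ψ : AddChar (Fin d → ZMod N) ℂ, ψ ≠ 0 ∧
      2 * ((|(d : ℝ) + 2 + 3| + 1) * √(P * Λ)) < ‖(L.map ψ).sum‖) ≤ Real.exp (-2 * Λ) := by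
  classical
  have h := wordProb_exists_le_card_mul
    (Finset.univ.filter fun ψ : AddChar (Fin d → ZMod N) ℂ => ψ ≠ 0) P fun ψ hψ =>
      wordProb_lt_norm_charSum_le (Finset.mem_filter.1 hψ).2 hP (D := (d : ℝ) + 2) hΛ
  refine le_trans (wordProb_mono fun L _ => ?_) (h.trans ?_)
  · rintro ⟨ψ, hψ, h⟩
    exact ⟨ψ, by simpa using hψ, h⟩
  · have hcard : ((Finset.univ.filter fun ψ : AddChar (Fin d → ZMod N) ℂ => ψ ≠ 0).card : ℝ) ≤
        Real.exp (d * Λ) := by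
      have h1 : (Finset.univ.filter fun ψ : AddChar (Fin d → ZMod N) ℂ => ψ ≠ 0).card ≤ N ^ d :=
        (Finset.card_filter_le _ _).trans_eq (by
          rw [Finset.card_univ, AddChar.card_eq, card_pi_zmod])
      calc _ ≤ ((N ^ d : ℕ) : ℝ) := by exact_mod_cast h1
        _ = _ := by rw [Nat.cast_pow, hN, Real.exp_nat_mul]
    calc _ ≤ Real.exp (d * Λ) * Real.exp (-((d : ℝ) + 2) * Λ) := by gcongr
      _ = _ := by rw [← Real.exp_add]; congr 1; ring

lemma card_zmod_eq_exp {N d : ℕ} [NeZero N] {Λ : ℝ} (hN : (N : ℝ) = Real.exp Λ) :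
    (Fintype.card (Fin d → ZMod N) : ℝ) = Real.exp (d * Λ) := by
  rw [card_pi_zmod, Nat.cast_pow, hN, Real.exp_nat_mul]

/-- The side length of the box that contains the grid points of a cube of volume
`exp (-(l * β * Λ))`. -/
def boxSide (N d : ℕ) (β Λ : ℝ) (l : ℕ) : ℕ := ⌊N * Real.exp (-(l * β / d) * Λ)⌋₊ + 1

lemma card_box_boxSide_le {N d : ℕ} {β Λ : ℝ} {l : ℕ} (hd : d ≠ 0) (hΛ : 1 ≤ Λ)
    (hN : (N : ℝ) = Real.exp Λ) (hl : l * β ≤ d) :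
    ((box N d (boxSide N d β Λ l)).card : ℝ) ≤ 2 ^ d * Real.exp ((d - l * β) * Λ) := by
  have hd' : (0 : ℝ) < d := by exact_mod_cast Nat.pos_of_ne_zero hd
  have hle : l * β / d ≤ 1 := (div_le_one hd').2 hl
  have e : N * Real.exp (-(l * β / d) * Λ) = Real.exp ((1 - l * β / d) * Λ) := by
    rw [hN, ← Real.exp_add]; congr 1; ring
  have h1 : (1 : ℝ) ≤ Real.exp ((1 - l * β / d) * Λ) := Real.one_le_exp (by nlinarith)
  have h2 : (boxSide N d β Λ l : ℝ) ≤ 2 * Real.exp ((1 - l * β / d) * Λ) := by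
    rw [boxSide, e]
    push_cast
    linarith [Nat.floor_le (zero_le_one.trans h1)]
  calc ((box N d (boxSide N d β Λ l)).card : ℝ) ≤ ((boxSide N d β Λ l ^ d : ℕ) : ℝ) := by
        exact_mod_cast card_box_le _
    _ ≤ (2 * Real.exp ((1 - l * β / d) * Λ)) ^ d := by
        rw [Nat.cast_pow]; gcongr
    _ = 2 ^ d * Real.exp ((d - l * β) * Λ) := by
        rw [mul_pow, ← Real.exp_nat_mul]
        congr 2
        field_simp

lemma exists_box_tail {d : ℕ} {β : ℝ} (hβ : 0 < β) (hβd : β < d) (D : ℝ) {l : ℕ} (hl0 : l ≠ 0)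
    (hl : l * β ≤ d) :
    ∃ K : ℝ, 0 ≤ K ∧ ∀ (N : ℕ) [NeZero N] (Λ : ℝ) (P : ℕ) (v : Fin d → ZMod N), 1 ≤ Λ →
      (N : ℝ) = Real.exp Λ → 1 ≤ P → (P : ℝ) ≤ Real.exp (β * Λ) →
      wordProb P (fun L => K * Λ < setCount l L (box N d (boxSide N d β Λ l)) v) ≤
        Real.exp (-D * Λ) := by
  have hd : d ≠ 0 := by
    rintro rfl
    simp only [Nat.cast_zero] at hβd
    linarith
  obtain ⟨K, hK0, hK⟩ := exists_setCount_tail_of_bounded l hl0 ((l : ℝ) ^ d) (2 ^ d) β d D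
    (by positivity) (by positivity) hβ
  refine ⟨K, hK0, fun N _ Λ P v hΛ hN hP hPβ => ?_⟩
  have hcard := card_zmod_eq_exp (d := d) hN
  have bound : ∀ j : ℕ, (P : ℝ) ^ j * (box N d (boxSide N d β Λ l)).card /
      Fintype.card (Fin d → ZMod N) ≤ 2 ^ d * Real.exp ((j * β - l * β) * Λ) := fun j => by
    rw [hcard, div_le_iff₀ (Real.exp_pos _)]
    calc (P : ℝ) ^ j * (box N d (boxSide N d β Λ l)).card
        ≤ Real.exp (β * Λ) ^ j * (2 ^ d * Real.exp ((d - l * β) * Λ)) := by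
          gcongr
          exact card_box_boxSide_le hd hΛ hN hl
      _ = 2 ^ d * (Real.exp (j * (β * Λ)) * Real.exp ((d - l * β) * Λ)) := by
          rw [Real.exp_nat_mul]; ring
      _ = 2 ^ d * (Real.exp ((j * β - l * β) * Λ) * Real.exp (d * Λ)) := by
          rw [← Real.exp_add, ← Real.exp_add]; congr 2; ring
      _ = _ := by ring
  refine hK _ Λ P P _ v hΛ hcard.le (fiberBound_zmod l) hP le_rfl ?_ ?_
  · simpa using bound l
  · refine (bound (l - 1)).trans_eq ?_
    rw [Nat.cast_sub (Nat.one_le_iff_ne_zero.2 hl0)]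
    congr 2
    push_cast
    ring

/-- With high probability all boxes contain few sums of at most `d / β` letters. -/
lemma exists_boxes_tail {d : ℕ} {β : ℝ} (hβ : 0 < β) (hβd : β < d) :
    ∃ K : ℝ, 0 ≤ K ∧ ∀ (N : ℕ) [NeZero N] (Λ : ℝ) (P : ℕ), 1 ≤ Λ →
      (N : ℝ) = Real.exp Λ → 1 ≤ P → (P : ℝ) ≤ Real.exp (β * Λ) →
      wordProb P (fun L => ∃ l : ℕ, 1 ≤ l ∧ (l : ℝ) ≤ d / β ∧ ∃ v : Fin d → ZMod N,
        K * Λ < setCount l L (box N d (boxSide N d β Λ l)) v) ≤ Real.exp (-2 * Λ) := by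
  set M : ℕ := ⌊d / β⌋₊ with hM
  have hdβ : (0 : ℝ) ≤ d / β := by positivity
  have hMle : ∀ l : ℕ, (l : ℝ) ≤ d / β ↔ l ≤ M := fun l => (Nat.le_floor_iff hdβ).symm
  have ex : ∀ j : Fin M, _ := fun j => exists_box_tail hβ hβd (2 + M + d) (l := j + 1)
    (Nat.succ_ne_zero _) ((le_div_iff₀ hβ).1 ((hMle _).2 j.2))
  choose K hK0 hK using ex
  refine ⟨∑ j, K j, Finset.sum_nonneg fun j _ => hK0 j, fun N _ Λ P hΛ hN hP hPβ => ?_⟩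
  refine le_trans (wordProb_mono fun L _ => ?_) (wordProb_exists_lt_exists_le (l := M) hΛ
    (card_zmod_eq_exp (d := d) hN).le (E := fun j v L => ∑ j, K j * Λ <
      setCount (j + 1) L (box N d (boxSide N d β Λ (j + 1))) v) fun j hj v => ?_)
  · rintro ⟨l, hl1, hl, v, h⟩
    obtain ⟨j, rfl⟩ := Nat.exists_eq_succ_of_ne_zero (Nat.one_le_iff_ne_zero.1 hl1)
    exact ⟨j, Finset.mem_range.2 ((hMle _).1 hl), v, Finset.mem_univ v, by rwa [← Finset.sum_mul]⟩
  · refine le_trans (wordProb_mono fun L _ h => lt_of_le_of_lt ?_ h)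
      (hK ⟨j, hj⟩ N Λ P v hΛ hN hP hPβ)
    exact Finset.single_le_sum (f := fun j => K j * Λ)
      (fun i _ => mul_nonneg (hK0 i) (by linarith)) (Finset.mem_univ (⟨j, hj⟩ : Fin M))

/-- With high probability all representation counts up to order `n` are close to their means. -/
lemma exists_repDevs_tail {d : ℕ} {β : ℝ} (hβ : 0 < β) (hβd : β < d) (n : ℕ) :
    ∃ K : ℝ, 0 ≤ K ∧ ∀ (N : ℕ) [NeZero N] (Λ : ℝ) (P : ℕ), 1 ≤ Λ →
      (N : ℝ) = Real.exp Λ → Nat.gcd n.factorial N = 1 → 1 ≤ P →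
      Real.exp (β * Λ) ≤ 2 * P → (P : ℝ) ≤ Real.exp (β * Λ) →
      wordProb P (fun L => ∃ l ≤ n, ∃ u : Fin d → ZMod N,
        K * devScale β d l P Λ < |repDev l L u|) ≤ Real.exp (-2 * Λ) := by
  have ex : ∀ j : Fin (n + 1), _ := fun j =>
    exists_repDev_tail β d hβ (hβ.trans hβd) j (2 + (n + 1 : ℕ) + d)
  choose K hK1 hK using ex
  have hK0 : ∀ j, 0 ≤ K j := fun j => zero_le_one.trans (hK1 j)
  refine ⟨∑ j, K j, Finset.sum_nonneg fun j _ => hK0 j, fun N _ Λ P hΛ hN hgcd hP hPβ' hPβ => ?_⟩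
  refine le_trans (wordProb_mono fun L _ => ?_) (wordProb_exists_lt_exists_le (l := n + 1) hΛ
    (card_zmod_eq_exp (d := d) hN).le (E := fun l u L => (∑ j, K j) * devScale β d l P Λ <
      |repDev l L u|) fun j hj v => ?_)
  · rintro ⟨l, hl, v, h⟩
    exact ⟨l, Finset.mem_range.2 (Nat.lt_succ_of_le hl), v, Finset.mem_univ v, h⟩
  · refine le_trans (wordProb_mono fun L _ h => lt_of_le_of_lt ?_ h)
      (hK ⟨j, hj⟩ _ Λ P P v hΛ (card_zmod_eq_exp (d := d) hN)
        (bijectiveNSMul_zmod hgcd (Nat.lt_succ_iff.1 hj)) hPβ' hPβ hP le_rfl)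
    refine mul_le_mul_of_nonneg_right (Finset.single_le_sum (f := K)
      (fun i _ => hK0 i) (Finset.mem_univ (⟨j, hj⟩ : Fin (n + 1)))) ?_
    rw [devScale]
    split_ifs
    · exact zero_le_one
    · exact Real.sqrt_nonneg _

lemma inv_pow_le {β Λ : ℝ} {P : ℕ} (l : ℕ) (hPβ : Real.exp (β * Λ) ≤ 2 * P) :
    ((P : ℝ) ^ l)⁻¹ ≤ 2 ^ l * Real.exp (-(l * β) * Λ) := by
  have h1 := pow_le_pow_left₀ (Real.exp_pos _).le hPβ l
  rw [← Real.exp_nat_mul, mul_pow] at h1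
  have h2 : (0 : ℝ) < P ^ l := by
    have := (Real.exp_pos (l * (β * Λ))).trans_le h1
    exact pos_of_mul_pos_right this (by positivity)
  rw [inv_le_iff_one_le_mul₀ h2]
  calc (1 : ℝ) = Real.exp (l * (β * Λ)) * Real.exp (-(l * β) * Λ) := by
        rw [← Real.exp_add, ← Real.exp_zero]; congr 1; ring
    _ ≤ 2 ^ l * P ^ l * Real.exp (-(l * β) * Λ) := by gcongr
    _ = _ := by ring

/-- The three properties hold simultaneously for the letters of some word. -/
lemma exists_word {d : ℕ} {β : ℝ} (hβ : 0 < β) (hβd : β < d) :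
    ∃ C₂ : ℝ, 0 ≤ C₂ ∧ ∀ n : ℕ, ∃ C₃ : ℝ, 0 ≤ C₃ ∧ ∀ (N : ℕ) [NeZero N] (Λ : ℝ) (P : ℕ), 1 ≤ Λ →
      (N : ℝ) = Real.exp Λ → Nat.gcd n.factorial N = 1 → 1 ≤ P →
      Real.exp (β * Λ) ≤ 2 * P → (P : ℝ) ≤ Real.exp (β * Λ) →
      ∃ L : List (Fin d → ZMod N), L.length = P ∧
        (∀ ψ : AddChar (Fin d → ZMod N) ℂ, ψ ≠ 0 →
          ‖(L.map ψ).sum‖ ≤ 2 * (d + 6) * √(P * Λ)) ∧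
        (∀ l : ℕ, 1 ≤ l → (l : ℝ) ≤ d / β → ∀ v : Fin d → ZMod N,
          setCount l L (box N d (boxSide N d β Λ l)) v ≤ C₂ * Λ) ∧
        ∀ l ≤ n, ∀ u : Fin d → ZMod N, |repDev l L u| ≤ C₃ * devScale β d l P Λ := by
  classical
  obtain ⟨C₂, hC₂, h₂⟩ := exists_boxes_tail hβ hβd
  refine ⟨C₂, hC₂, fun n => ?_⟩
  obtain ⟨C₃, hC₃, h₃⟩ := exists_repDevs_tail hβ hβd n
  refine ⟨C₃, hC₃, fun N _ Λ P hΛ hN hgcd hP hPβ' hPβ => ?_⟩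
  have e1 := wordProb_charSum_le N d hP hΛ hN
  have e2 := h₂ N Λ P hΛ hN hP hPβ
  have e3 := h₃ N Λ P hΛ hN hgcd hP hPβ' hPβ
  have hsmall : Real.exp (-2 * Λ) < 1 / 3 := by
    have h1 : Real.exp (-2 * Λ) * Real.exp (2 * Λ) = 1 := by rw [← Real.exp_add]; simp
    have h2 := Real.add_one_le_exp (2 * Λ)
    have h3 : 3 < Real.exp (2 * Λ) := by
      have h4 := Real.add_one_lt_exp (show (2 * Λ) ≠ 0 by linarith)
      linarith
    nlinarith [Real.exp_pos (-2 * Λ)]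
  have hor := wordProb_or_le P _ _ |>.trans (add_le_add e1
    (wordProb_or_le P _ _ |>.trans (add_le_add e2 e3)))
  obtain ⟨L, hL, hgood⟩ := exists_not_of_wordProb_lt_one
    (lt_of_le_of_lt hor (show _ < (1 : ℝ) by linarith))
  push Not at hgood
  obtain ⟨g1, g2, g3⟩ := hgood
  refine ⟨L, hL, fun ψ hψ => (g1 ψ hψ).trans_eq ?_, g2, g3⟩
  rw [abs_of_nonneg (by positivity)]
  ring

/-- The points exist, with constants that may be chosen separately for each `β`, `d` and `n`, and
such that `C₂` is chosen before `n`. -/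
lemma exists_points (β : ℝ) (d : ℕ) : ∃ C₂ : ℝ, ∀ n : ℕ, ∃ C₃ : ℝ, 0 < β → β < d →
    ∀ N : ℕ, 3 ≤ N → Nat.gcd n.factorial N = 1 →
      ∃ x : Fin ⌊(N : ℝ) ^ β⌋₊ → Torus d,
        (∀ j, x j ∈ grid N d) ∧
        (∀ r ∈ grid N d, r ≠ 0 →
          ∀ k : Fin d → ℤ, (∀ i, r i = (((k i : ℝ) / (N : ℝ) : ℝ) : UnitAddCircle)) →
            ‖fourierTransform (pointMassAverage x) k‖ ≤
              4 * (d + 6) * (N : ℝ) ^ (-β / 2) * (Real.log N) ^ (1 / 2 : ℝ)) ∧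
        (∀ l : ℕ, 1 ≤ l → (l : ℝ) ≤ d / β →
          ∀ Q : Set (Torus d), IsCube Q →
            (volume : Measure (Torus d)).real Q ≤ (N : ℝ) ^ (-(l * β)) →
            (convPow (pointMassAverage x) l).real Q ≤
              C₂ * (N : ℝ) ^ (-(l * β)) * Real.log N) ∧
        (∀ l : ℕ, d / β ≤ (l : ℝ) → l ≤ n →
          ∀ u ∈ grid N d,
            |(convPow (pointMassAverage x) l).real {u} - (N : ℝ) ^ (-(d : ℝ))| ≤
              C₃ * ((N : ℝ) ^ (-(d : ℝ)) * (Real.log N) ^ (((l : ℝ) + 1) / 2) /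
                (N : ℝ) ^ ((l * β - d) / 2))) := by
  classical
  by_cases hyp : 0 < β ∧ β < d
  swap
  · exact ⟨0, fun n => ⟨0, fun h1 h2 => absurd ⟨h1, h2⟩ hyp⟩⟩
  obtain ⟨hβ, hβd⟩ := hyp
  have hd : d ≠ 0 := by
    rintro rfl
    simp only [Nat.cast_zero] at hβd
    linarith
  have hd' : (0 : ℝ) < d := by exact_mod_cast Nat.pos_of_ne_zero hd
  obtain ⟨C₂, hC₂, hword⟩ := exists_word hβ hβd
  refine ⟨C₂ * 2 ^ ⌊d / β⌋₊, fun n => ?_⟩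
  obtain ⟨C₃, hC₃, hword⟩ := hword n
  refine ⟨C₃ * 2 ^ n, fun _ _ N hN3 hgcd => ?_⟩
  have : NeZero N := ⟨by omega⟩
  have hN3' : (3 : ℝ) ≤ N := by exact_mod_cast hN3
  have hN0 : (0 : ℝ) < N := by linarith
  have hrpow : ∀ y : ℝ, (N : ℝ) ^ y = Real.exp (y * Real.log N) := fun y => by
    rw [Real.rpow_def_of_pos hN0, mul_comm]
  have hNexp : (N : ℝ) = Real.exp (Real.log N) := (Real.exp_log hN0).symm
  have hΛ : 1 ≤ Real.log N := by
    rw [Real.le_log_iff_exp_le hN0]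
    exact Real.exp_one_lt_three.le.trans hN3'
  have hNβ : (1 : ℝ) ≤ (N : ℝ) ^ β := Real.one_le_rpow (by linarith) hβ.le
  have hP : 1 ≤ ⌊(N : ℝ) ^ β⌋₊ := Nat.le_floor (by simpa using hNβ)
  have hPβ : (⌊(N : ℝ) ^ β⌋₊ : ℝ) ≤ Real.exp (β * Real.log N) := by
    rw [← hrpow]
    exact Nat.floor_le (by linarith)
  have hPβ' : Real.exp (β * Real.log N) ≤ 2 * (⌊(N : ℝ) ^ β⌋₊ : ℝ) := by
    rw [← hrpow]
    have h1 := Nat.lt_floor_add_one ((N : ℝ) ^ β)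
    have h2 : (1 : ℝ) ≤ ⌊(N : ℝ) ^ β⌋₊ := by exact_mod_cast hP
    linarith
  obtain ⟨L, hL, g1, g2, g3⟩ := hword N _ _ hΛ hNexp hgcd hP hPβ' hPβ
  rw [← hL] at hP hPβ' g1 g3 ⊢
  simp only [hrpow]
  set Λ := Real.log N with hΛdef
  have hP0 : (0 : ℝ) < L.length := by exact_mod_cast hP
  refine ⟨fun j => gridHom N d L[j], fun j => gridHom_mem_grid _, ?_, ?_, ?_⟩
  · intro r _ hr k hk
    rw [norm_fourierTransform_pointMassAverage]
    have h1 := g1 _ (gridChar_ne_zero hr hk)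
    have h2 : √(L.length * Λ) ≤ 2 * Real.exp (-β / 2 * Λ) * L.length * √Λ := by
      have e : (1 : ℝ) ≤ 2 * L.length * Real.exp (-β * Λ) := by
        calc (1 : ℝ) = Real.exp (β * Λ) * Real.exp (-β * Λ) := by rw [← Real.exp_add]; simp
          _ ≤ _ := by gcongr
      have e' : Real.exp (-β / 2 * Λ) ^ 2 = Real.exp (-β * Λ) := by
        rw [← Real.exp_nat_mul]; congr 1; push_cast; ring
      rw [← Real.sqrt_sq (show 0 ≤ 2 * Real.exp (-β / 2 * Λ) * L.length by positivity),
        ← Real.sqrt_mul (by positivity)]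
      refine Real.sqrt_le_sqrt (mul_le_mul_of_nonneg_right ?_ (by linarith))
      rw [mul_pow, mul_pow, e']
      nlinarith
    rw [div_le_iff₀ hP0, ← Real.sqrt_eq_rpow]
    refine h1.trans ?_
    calc 2 * ((d : ℝ) + 6) * √(L.length * Λ)
        ≤ 2 * ((d : ℝ) + 6) * (2 * Real.exp (-β / 2 * Λ) * L.length * √Λ) := by gcongr
      _ = _ := by ring
  · intro l hl1 hl Q hQ hvol
    have hlβ : l * β ≤ d := (le_div_iff₀ hβ).1 hl
    have hw : Real.exp (-(l * β / d) * Λ) ^ d = Real.exp (-(l * β) * Λ) := by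
      rw [← Real.exp_nat_mul]; congr 1; field_simp
    rw [← hw] at hvol
    obtain ⟨c, hc⟩ := exists_box_of_isCube (N := N) hd hQ (Real.exp_pos _).le hvol
    have h1 : setCount l L (gridPoints N Q) 0 ≤ C₂ * Λ :=
      (setCount_le_of_sub_mem hc).trans (g2 l hl1 hl _)
    have h2 : (2 : ℝ) ^ l ≤ 2 ^ ⌊d / β⌋₊ := pow_le_pow_right₀ one_le_two (Nat.le_floor hl)
    rw [convPow_real_eq, div_eq_mul_inv]
    calc _ ≤ C₂ * Λ * (2 ^ ⌊d / β⌋₊ * Real.exp (-(l * β) * Λ)) := by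
          refine mul_le_mul h1 ((inv_pow_le l hPβ').trans ?_) (by positivity) (by positivity)
          gcongr
      _ = _ := by ring
  · intro l hl hln u hu
    obtain ⟨g, rfl⟩ := exists_gridHom_eq hu
    have hlβ : ¬ l * β < d := not_lt.2 ((div_le_iff₀ hβ).1 hl)
    have hpts : gridPoints N {gridHom N d g} = {g} := by
      ext h
      simp [gridPoints, gridHom_injective.eq_iff]
    have hq0 : (0 : ℝ) < (L.length : ℝ) ^ l := by positivity
    have e1 : (convPow (pointMassAverage fun j : Fin L.length => gridHom N d L[j]) l).real
        {gridHom N d g} - Real.exp (-(d : ℝ) * Λ) = repDev l L g / (L.length : ℝ) ^ l := by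
      rw [convPow_real_eq]
      change setCount l L (gridPoints N {gridHom N d g}) 0 / _ - _ = _
      rw [hpts, setCount_singleton, repDev, card_zmod_eq_exp hNexp, neg_mul,
        Real.exp_neg]
      field_simp
    have e2 : Real.exp (-(d : ℝ) * Λ) * Λ ^ (((l : ℝ) + 1) / 2) / Real.exp ((l * β - d) / 2 * Λ) =
        √(Λ ^ (l + 1)) * Real.exp (-(l * β + d) / 2 * Λ) := by
      have h1 : Λ ^ (((l : ℝ) + 1) / 2) = √(Λ ^ (l + 1)) := by
        rw [Real.sqrt_eq_rpow, ← Real.rpow_natCast, ← Real.rpow_mul (by linarith)]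
        congr 1
        push_cast
        ring
      rw [h1, div_eq_mul_inv, ← Real.exp_neg, mul_comm (Real.exp _), mul_assoc, ← Real.exp_add]
      congr 2
      ring
    have e3 : devScale β d l L.length Λ ≤
        2 ^ n * (√(Λ ^ (l + 1)) * Real.exp (-(l * β + d) / 2 * Λ)) * (L.length : ℝ) ^ l := by
      have h1 : (1 : ℝ) ≤ 2 ^ l * Real.exp (-(l * β) * Λ) * (L.length : ℝ) ^ l := by
        have := mul_le_mul_of_nonneg_right (inv_pow_le l hPβ') hq0.le
        rwa [inv_mul_cancel₀ hq0.ne'] at this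
      have h2 : (2 : ℝ) ^ l ≤ (2 ^ n) ^ 2 := by
        rw [← pow_mul]; exact pow_le_pow_right₀ one_le_two (by omega)
      have h3 : Real.exp (-(l * β + d) / 2 * Λ) ^ 2 =
          Real.exp (-(l * β) * Λ) * (Real.exp (d * Λ))⁻¹ := by
        rw [← Real.exp_nat_mul, ← Real.exp_neg, ← Real.exp_add]; congr 1; push_cast; ring
      rw [devScale, if_neg hlβ]
      refine Real.sqrt_le_iff.2 ⟨by positivity, ?_⟩
      rw [mul_pow, mul_pow, mul_pow, Real.sq_sqrt (by positivity), h3]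
      calc (L.length : ℝ) ^ l * Λ ^ (l + 1) / Real.exp (d * Λ)
          = 1 * ((L.length : ℝ) ^ l * Λ ^ (l + 1) * (Real.exp (d * Λ))⁻¹) := by ring
        _ ≤ (2 ^ n) ^ 2 * Real.exp (-(l * β) * Λ) * (L.length : ℝ) ^ l *
            ((L.length : ℝ) ^ l * Λ ^ (l + 1) * (Real.exp (d * Λ))⁻¹) := by
            refine mul_le_mul_of_nonneg_right (h1.trans ?_) (by positivity)
            gcongr
        _ = _ := by ring
    rw [e1, e2, abs_div, abs_of_pos hq0, div_le_iff₀ hq0]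
    refine (g3 l hln g).trans ?_
    calc C₃ * devScale β d l L.length Λ ≤ C₃ * (2 ^ n * (√(Λ ^ (l + 1)) *
          Real.exp (-(l * β + d) / 2 * Λ)) * (L.length : ℝ) ^ l) := by gcongr
      _ = _ := by ring

end PointMasses

end

theorem mainTheorem9 :
    ∃ (N₀ : ℝ → ℕ → ℕ) (C₁ : ℕ → ℝ) (C₂ : ℝ → ℕ → ℝ) (C₃ : ℝ → ℕ → ℕ → ℝ),
      ∀ (d : ℕ) (β : ℝ) (n : ℕ), 0 < β → β < (d : ℝ) → 2 ≤ n →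
        1 ≤ N₀ β n ∧
        ∀ N : ℕ, N₀ β n ≤ N → Nat.gcd (Nat.factorial n) N = 1 →
          ∃ x : Fin ⌊(N : ℝ) ^ β⌋₊ → PointMasses.Torus d,
            (∀ j, x j ∈ PointMasses.grid N d) ∧
            (∀ r ∈ PointMasses.grid N d, r ≠ 0 →
              ∀ k : Fin d → ℤ, (∀ i, r i = (((k i : ℝ) / (N : ℝ) : ℝ) : UnitAddCircle)) →
                ‖PointMasses.fourierTransform (PointMasses.pointMassAverage x) k‖ ≤
                  C₁ d * (N : ℝ) ^ (-β / 2) * (Real.log N) ^ (1 / 2 : ℝ)) ∧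
            (∀ l : ℕ, 1 ≤ l → (l : ℝ) ≤ d / β →
              ∀ Q : Set (PointMasses.Torus d), PointMasses.IsCube Q →
                (MeasureTheory.volume : MeasureTheory.Measure (PointMasses.Torus d)).real Q ≤
                  (N : ℝ) ^ (-(l * β)) →
                (PointMasses.convPow (PointMasses.pointMassAverage x) l).real Q ≤
                  C₂ β d * (N : ℝ) ^ (-(l * β)) * Real.log N) ∧
            (∀ l : ℕ, d / β ≤ (l : ℝ) → l ≤ n →
              ∀ u ∈ PointMasses.grid N d,
                |(PointMasses.convPow (PointMasses.pointMassAverage x) l).real {u} -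
                    (N : ℝ) ^ (-(d : ℝ))| ≤
                  C₃ β d n * ((N : ℝ) ^ (-(d : ℝ)) * (Real.log N) ^ (((l : ℝ) + 1) / 2) /
                    (N : ℝ) ^ ((l * β - d) / 2))) := by

  -- `3 ≤ N` ensures `1 ≤ log N`, the only lower bound on `N` that the estimates need
  choose C₂ C₃ h using PointMasses.exists_points
  exact ⟨fun _ _ => 3, fun d => 4 * (d + 6), C₂, C₃, fun d β n hβ hβd _ =>
    ⟨by norm_num, fun N hN hgcd => h β d n hβ hβd N hN hgcd⟩⟩
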